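/- Let $n\ge 1$. A vector space $X$ of (real- or complex-valued) measurable functions on $\mathbb{R}^n$, identified when equal a.e., with a norm $\|\cdot\|_X$ is called a Banach function space over $\mathbb{R}^n$ if: (a) if $f\in X$ and $g$ is measurable with $|g|\le |f|$ a.e., then $g\in X$ and $\|g\|_X\le\|f\|_X$; (b) if $f_j\in X$, $0\le f_j\uparrow f$ a.e. and $\sup_j\|f_j\|_X<\infty$, then $f\in X$ and $\|f\|_X=\sup_j\|f_j\|_X$; (c) every measurable set $E$ of positive measure contains a measurable set $F$ of positive measure with $\chi_F\in X$. Put $\|f\|_X=\infty$ if $f\notin X$. The associate space $X'$ consists of all measurable $f$ with $\|f\|_{X'}:=\sup_{\|g\|_X\le 1}\int_{\mathbb{R}^n}|fg|<\infty$. Throughout, $Q$ denotes cubes in $\mathbb{R}^n$ with sides parallel to the axes. Let $Mf(x)=\sup_{Q\ni x}\frac1{|Q|}\int_Q|f|$ be the Hardy–Littlewood maximal operator; $M$ is bounded on $X$ if there is $C<\infty$ with $\|Mf\|_X\le C\|f\|_X$ for all $f\in X$. For $\lambda\in(0,1)$ let $m_\lambda f(x)=\sup_{Q\ni x}(f\chi_Q)^*(\lambda|Q|)$,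 where $f^*(t)=\inf\{\alpha>0: |\{|f|>\alpha\}|\le t\}$ is the non-increasing rearrangement, and let $\varphi_X(\lambda)=\inf_{\|f\|_X=1}\|m_\lambda f\|_X\in[0,\infty]$; $\varphi_{X'}$ is defined in the same way from $X'$. A weight is a non-negative locally integrable function $w$ on $\mathbb{R}^n$; put $w(Q)=\int_Q w$ and $[w]_{A_\infty}=\sup_Q\frac{1}{w(Q)}\int_Q M(w\chi_Q)$ (with $0/0=0$). The space $X$ is $A_\infty$-regular if there are finite $C_1,C_2>0$ such that for every $f\in X$ there is a weight $w$ with $|f|\le w$ a.e., $[w]_{A_\infty}\le C_1$ and $\|w\|_X\le C_2\|f\|_X$. **Theorem 1.1.** Let $X$ be a Banach function space over $\mathbb{R}^n$, and assume that $M$ is bounded on $X$. Then: (i) The function $\varphi_{X'}$ is unbounded on $(0,1)$; in fact, there are $C,\delta>0$ (depending on $X$) such that $\varphi_{X'}(\lambda)\ge C\lambda^{-\delta}$ for all $\lambda\in(0,1)$. (ii) If there is $\lambda_0\in(0,1)$ such that $\varphi_X(\lambda_0)>1$, then $M$ is bounded on $X'$. Moreover, the conclusion of (i) holds for every $A_\infty$-regular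 Banach function space $X$ over $\mathbb{R}^n$, whether or not $M$ is bounded on $X$. -/

import Mathlib

open MeasureTheory Filter Topology Set
open scoped ENNReal NNReal ComplexOrder

noncomputable section

namespace MaximalBFS

/-- `L⁰(ℝⁿ)`: measurable `𝕜`-valued functions on `ℝⁿ` modulo equality almost everywhere
(`𝕜` is `ℝ` or `ℂ`; the measure on `Fin n → ℝ` is Lebesgue measure). -/
abbrev L0 (𝕜 : Type*) [RCLike 𝕜] (n : ℕ) : Type _ := (Fin n → ℝ) →ₘ[volume] 𝕜

/-- A space `X ⊆ L⁰(ℝⁿ)` together with a gauge `‖·‖_X` is encoded by the gauge extended by `∞`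
outside of `X`: `X f` is `‖f‖_X`, and `f ∈ X` means `X f < ∞`. Every norm axiom is
required in `IsBanachFunctionSpace` below. -/
abbrev FunctionSpace (𝕜 : Type*) [RCLike 𝕜] (n : ℕ) : Type _ := L0 𝕜 n → ℝ≥0∞

variable {𝕜 : Type*} [RCLike 𝕜] {n : ℕ}

/-- The extended norm `‖g‖_X` of a `[0, ∞]`-valued function `g`: it is the norm of (the class of)
`g` if `g` is measurable and finite almost everywhere, and `∞` otherwise. -/
def FunctionSpace.normOf (X : FunctionSpace 𝕜 n) (g : (Fin n → ℝ) → ℝ≥0∞) : ℝ≥0∞ :=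
  open Classical in
  if h : AEMeasurable g volume ∧ ∀ᵐ x, g x < ∞ then
    X (AEEqFun.mk (fun x => (((g x).toReal : ℝ) : 𝕜))
      (RCLike.measurable_ofReal.comp_aemeasurable h.1.ennreal_toReal).aestronglyMeasurable)
  else ∞

/-- Banach function spaces over `ℝⁿ`: the set `{f | X f < ∞}` is a vector space, `X` restricted to
it is a norm, and the ideal, Fatou and saturation properties hold. -/
structure IsBanachFunctionSpace (X : FunctionSpace 𝕜 n) : Prop where
  definite : ∀ f, X f = 0 → f = 0
  smul : ∀ (c : 𝕜) (f : L0 𝕜 n), X (c • f) = ‖c‖ₑ * X f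
  add_le : ∀ f g, X (f + g) ≤ X f + X g
  ideal : ∀ f g : L0 𝕜 n, (∀ᵐ x, ‖g x‖ ≤ ‖f x‖) → X g ≤ X f
  fatou : ∀ (f : ℕ → L0 𝕜 n) (g : L0 𝕜 n),
    (∀ j, ∀ᵐ x, 0 ≤ f j x ∧ f j x ≤ f (j + 1) x) →
    (∀ᵐ x, Tendsto (fun j => f j x) atTop (𝓝 (g x))) →
    (⨆ j, X (f j)) < ∞ → X g = ⨆ j, X (f j)
  saturation : ∀ E : Set (Fin n → ℝ), MeasurableSet E → 0 < volume E →
    ∃ F ⊆ E, MeasurableSet F ∧ 0 < volume F ∧ X.normOf (F.indicator 1) < ∞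

/-- The associate space (Köthe dual) `X'`, with `‖f‖_{X'} = sup_{‖g‖_X ≤ 1} ∫ |f g|`. -/
def FunctionSpace.associate (X : FunctionSpace 𝕜 n) : FunctionSpace 𝕜 n :=
  fun f => ⨆ (g : L0 𝕜 n) (_ : X g ≤ 1), ∫⁻ x, ‖f x * g x‖ₑ

/-- (Open, axis-parallel, non-degenerate) cubes in `ℝⁿ`. The operators `maximal` and
`localMaximal` below do not change if the cubes are taken closed. -/
def IsCube (Q : Set (Fin n → ℝ)) : Prop :=
  ∃ (a : Fin n → ℝ) (l : ℝ), 0 < l ∧ Q = {x | ∀ i, a i < x i ∧ x i < a i + l}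

/-- The Hardy–Littlewood maximal function of a function with modulus `g`. -/
def maximal (g : (Fin n → ℝ) → ℝ≥0∞) (x : Fin n → ℝ) : ℝ≥0∞ :=
  ⨆ (Q : Set (Fin n → ℝ)) (_ : IsCube Q) (_ : x ∈ Q), (∫⁻ y in Q, g y) / volume Q

/-- The non-increasing rearrangement `g^*(t) = inf {α > 0 : |{g > α}| ≤ t}`. -/
def rearrangement (g : (Fin n → ℝ) → ℝ≥0∞) (t : ℝ≥0∞) : ℝ≥0∞ :=
  sInf {α : ℝ≥0∞ | 0 < α ∧ volume {x | α < g x} ≤ t}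

/-- The local maximal function `m_s f (x) = sup_{Q ∋ x} (f χ_Q)^*(s |Q|)` of a function `f` with
modulus `g`. -/
def localMaximal (s : ℝ) (g : (Fin n → ℝ) → ℝ≥0∞) (x : Fin n → ℝ) : ℝ≥0∞ :=
  ⨆ (Q : Set (Fin n → ℝ)) (_ : IsCube Q) (_ : x ∈ Q),
    rearrangement (Q.indicator g) (ENNReal.ofReal s * volume Q)

/-- `M` is bounded on `X`: there is a finite `C` with `‖M f‖_X ≤ C ‖f‖_X` for all `f ∈ X`. -/
def MaximalBoundedOn (X : FunctionSpace 𝕜 n) : Prop :=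
  ∃ C : ℝ≥0, ∀ f : L0 𝕜 n, X f < ∞ → X.normOf (maximal fun x => ‖f x‖ₑ) ≤ C * X f

/-- `φ_X(s) = inf_{‖f‖_X = 1} ‖m_s f‖_X`. -/
def phi (X : FunctionSpace 𝕜 n) (s : ℝ) : ℝ≥0∞ :=
  ⨅ (f : L0 𝕜 n) (_ : X f = 1), X.normOf (localMaximal s fun x => ‖f x‖ₑ)

/-- Weights: non-negative locally integrable functions. -/
def IsWeight (w : (Fin n → ℝ) → ℝ) : Prop :=
  (∀ x, 0 ≤ w x) ∧ LocallyIntegrable w volume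

/-- The constant `[w]_{A_∞} = sup_Q (∫_Q M(w χ_Q)) / w(Q)` of a weight (with `0 / 0 = 0`). -/
def aInftyConst (w : (Fin n → ℝ) → ℝ) : ℝ≥0∞ :=
  ⨆ (Q : Set (Fin n → ℝ)) (_ : IsCube Q),
    (∫⁻ x in Q, maximal (Q.indicator fun y => ENNReal.ofReal (w y)) x) /
      ∫⁻ x in Q, ENNReal.ofReal (w x)

/-- `A_∞`-regularity of `X`: there are finite `C₁, C₂` such that every `f ∈ X` has an `A_∞`
majorant `w` with `[w]_{A_∞} ≤ C₁` and `‖w‖_X ≤ C₂ ‖f‖_X`. -/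
def IsAInftyRegular (X : FunctionSpace 𝕜 n) : Prop :=
  ∃ C₁ C₂ : ℝ≥0, 0 < C₁ ∧ 0 < C₂ ∧ ∀ f : L0 𝕜 n, X f < ∞ →
    ∃ w : (Fin n → ℝ) → ℝ, IsWeight w ∧ (∀ᵐ x, ‖f x‖ ≤ w x) ∧ aInftyConst w ≤ C₁ ∧
      X.normOf (fun x => ENNReal.ofReal (w x)) ≤ C₂ * X f

/-- A `[0, ∞]`-valued function on `(0, 1)` is unbounded. -/
def UnboundedOnUnit (φ : ℝ → ℝ≥0∞) : Prop :=
  ∀ K : ℝ≥0, ∃ s ∈ Ioo (0 : ℝ) 1, (K : ℝ≥0∞) < φ s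

/-- `φ(s) ≥ C s^{-δ}` on `(0, 1)` for some constants `C, δ > 0`. -/
def HasPowerLowerBound (φ : ℝ → ℝ≥0∞) : Prop :=
  ∃ C > (0 : ℝ), ∃ δ > (0 : ℝ), ∀ s ∈ Ioo (0 : ℝ) 1, ENNReal.ofReal (C * s ^ (-δ)) ≤ φ s

end MaximalBFS

end

noncomputable section

namespace MaximalBFS

open Metric

/-! ### Cubes as balls of the sup norm -/

section Cubes

variable {n : ℕ}

/-! Both halves rest on the identity {m_s f > a} = {M χ_{|f|>a} > s}: a superlevel set of m_s f is
the density set of the superlevel set of f (`lt_localMaximal_iff`). A Vitali covering shows that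
density sets compose with multiplicative loss, so m_s ∘ m_t ≤ m_{st/15^n} (`densitySet_comp`,
`localMaximal_comp_le`).

Part (i). If w is an A_∞ weight, sets of small relative measure in a cube carry a small share of the
mass of w (`exists_small_of_fujiiWilson`, from a reverse weak type inequality). Covering E by cubes
where its density has just dropped below a small threshold, Besicovitch gives 2 w(E) ≤ w({M χ_E >
s}) for a fixed s; iteration gives 2^k w(E) ≤ w({M χ_E > q^k}), and the layer cake formula turns
this into 2^k ∫|f|w ≤ ∫(m_s f)w for s ≤ q^k. Majorizing each g in the unit ball of X by such a w
yields 2^k ‖f‖_{X'} ≤ C₂ ‖m_s f‖_{X'}, a power bound in s. Boundedness of M on X supplies the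
majorants through the Rubio de Francia algorithm.

Part (ii). Iterating φ_X(s₀) > 1 gives some s with ‖m_s g‖_X ≥ 2^{n+1}‖g‖_X. By duality one must
bound ∫ MG·H for H in X. Up to the factor 4^n, MG is a supremum of averages at dyadic scales; for
finitely many scales, splitting H = Σ h_k according to the maximizing scale and using that averages
are self-adjoint reduces the claim to ‖Σ A_k h_k‖_X ≤ D‖H‖_X with D independent of the number of
scales. Let T_j be this sum with all radii multiplied by 2^j. Then m_s T_j ≤ 2^n T_{j+1} + (3^n/s)
MH (`localMaximal_sum_ballAverage_le`), and the expansion factor 2^{n+1} lets the supremum of ‖T_j‖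
be absorbed (`normOf_sum_ballAverage_le`). -/

theorem volume_ball_eq (c : Fin n → ℝ) {r : ℝ} (hr : 0 < r) :
    volume (ball c r) = ENNReal.ofReal ((2 * r) ^ n) := by
  simpa using Real.volume_pi_ball c hr

theorem volume_closedBall_eq (c c' : Fin n → ℝ) {r : ℝ} (hr : 0 < r) :
    volume (closedBall c r) = volume (ball c' r) := by
  rw [volume_ball_eq c' hr]
  simpa using Real.volume_pi_closedBall c hr.le

theorem volume_ball_mul (c c' : Fin n → ℝ) {k r : ℝ} (hk : 0 < k) (hr : 0 < r) :
    volume (ball c (k * r)) = ENNReal.ofReal k ^ n * volume (ball c' r) := by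
  rw [volume_ball_eq c (mul_pos hk hr), volume_ball_eq c' hr, ← ENNReal.ofReal_pow hk.le,
    ← ENNReal.ofReal_mul (by positivity)]
  congr 1
  rw [← mul_pow]
  ring

theorem volume_ball_ne_zero (c : Fin n → ℝ) {r : ℝ} (hr : 0 < r) : volume (ball c r) ≠ 0 :=
  (measure_ball_pos volume c hr).ne'

theorem volume_ball_ne_top (c : Fin n → ℝ) (r : ℝ) : volume (ball c r) ≠ ∞ :=
  measure_ball_lt_top.ne

theorem closedBall_ae_eq_ball (c : Fin n → ℝ) {r : ℝ} (hr : 0 < r) :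
    closedBall c r =ᵐ[volume] ball c r :=
  (ae_eq_of_subset_of_measure_ge ball_subset_closedBall
    (volume_closedBall_eq c c hr).le measurableSet_ball.nullMeasurableSet
    (measure_closedBall_lt_top.ne)).symm

theorem setLIntegral_closedBall (g : (Fin n → ℝ) → ℝ≥0∞) (c : Fin n → ℝ) {r : ℝ} (hr : 0 < r) :
    ∫⁻ y in closedBall c r, g y = ∫⁻ y in ball c r, g y :=
  setLIntegral_congr (closedBall_ae_eq_ball c hr)

theorem IsCube.exists_ball {Q : Set (Fin n → ℝ)} (hQ : IsCube Q) :
    ∃ c r, 0 < r ∧ Q = ball c r := by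
  obtain ⟨a, l, hl, rfl⟩ := hQ
  refine ⟨fun i => a i + l / 2, l / 2, by positivity, ?_⟩
  ext x
  simp only [ball_pi _ (half_pos hl), mem_ofPred_eq, Set.mem_pi, mem_univ, true_imp_iff, mem_ball,
    Real.dist_eq, abs_lt]
  refine forall_congr' fun i => ⟨fun h => ⟨by linarith, by linarith⟩,
    fun h => ⟨by linarith, by linarith⟩⟩

theorem isCube_ball (c : Fin n → ℝ) {r : ℝ} (hr : 0 < r) : IsCube (ball c r) := by
  refine ⟨fun i => c i - r, 2 * r, by positivity, ?_⟩
  ext x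
  simp only [ball_pi _ hr, mem_ofPred_eq, Set.mem_pi, mem_univ, true_imp_iff, mem_ball,
    Real.dist_eq, abs_lt]
  refine forall_congr' fun i => ⟨fun h => ⟨by linarith, by linarith⟩,
    fun h => ⟨by linarith, by linarith⟩⟩

/-- Sliding the centre from x towards c by the fraction r/(2l) leaves room r/2 in both cubes. It
bounds from below the part of a stopping cube inside the ambient cube. -/
theorem exists_ball_subset_inter {c x : Fin n → ℝ} {l r : ℝ} (hr : 0 < r) (hrl : r ≤ l)
    (hx : x ∈ ball c l) : ∃ c', ball c' (r / 2) ⊆ ball x r ∩ ball c l := by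
  have hl : 0 < l := hr.trans_le hrl
  have hxc : ‖x - c‖ < l := by simpa [dist_eq_norm] using hx
  have hθ : r / (2 * l) * l = r / 2 := by field_simp
  have hθ0 : 0 < r / (2 * l) := by positivity
  have hθ1 : r / (2 * l) ≤ 1 := by
    rw [div_le_one (by positivity)]; linarith
  refine ⟨x + (r / (2 * l)) • (c - x), fun y hy => ⟨?_, ?_⟩⟩
  · rw [mem_ball, dist_eq_norm] at hy ⊢
    have : y - x = (y - (x + (r / (2 * l)) • (c - x))) + (r / (2 * l)) • (c - x) := by abel
    rw [this]
    refine (norm_add_le _ _).trans_lt ?_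
    rw [norm_smul, Real.norm_of_nonneg hθ0.le, norm_sub_rev c x]
    nlinarith
  · rw [mem_ball, dist_eq_norm] at hy ⊢
    have : y - c = (y - (x + (r / (2 * l)) • (c - x))) + (1 - r / (2 * l)) • (x - c) := by
      rw [sub_smul, one_smul, ← neg_sub c x, smul_neg]; abel
    rw [this]
    refine (norm_add_le _ _).trans_lt ?_
    rw [norm_smul, Real.norm_of_nonneg (by linarith)]
    nlinarith [norm_nonneg (x - c)]

end Cubes

/-! ### Elementary properties of the maximal operator -/

section MaximalFunction

variable {n : ℕ}

theorem le_maximal (g : (Fin n → ℝ) → ℝ≥0∞) {c x : Fin n → ℝ} {r : ℝ} (hx : x ∈ ball c r) :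
    (∫⁻ y in ball c r, g y) / volume (ball c r) ≤ maximal g x :=
  le_iSup_of_le (ball c r) (le_iSup_of_le (isCube_ball c (pos_of_mem_ball hx))
    (le_iSup_of_le hx le_rfl))

theorem maximal_le {g : (Fin n → ℝ) → ℝ≥0∞} {x : Fin n → ℝ} {a : ℝ≥0∞}
    (h : ∀ c r, 0 < r → x ∈ ball c r → (∫⁻ y in ball c r, g y) / volume (ball c r) ≤ a) :
    maximal g x ≤ a := by
  refine iSup_le fun Q => iSup_le fun hQ => iSup_le fun hx => ?_
  obtain ⟨c, r, hr, rfl⟩ := hQ.exists_ball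
  exact h c r hr hx

theorem lt_maximal_iff {g : (Fin n → ℝ) → ℝ≥0∞} {x : Fin n → ℝ} {a : ℝ≥0∞} :
    a < maximal g x ↔
      ∃ c r, 0 < r ∧ x ∈ ball c r ∧ a < (∫⁻ y in ball c r, g y) / volume (ball c r) := by
  constructor
  · intro h
    by_contra! H
    exact h.not_ge (maximal_le H)
  · rintro ⟨c, r, hr, hx, h⟩
    exact h.trans_le (le_maximal g hx)

theorem setLIntegral_le_maximal (g : (Fin n → ℝ) → ℝ≥0∞) {c x : Fin n → ℝ} {r : ℝ}
    (hx : x ∈ ball c r) :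
    ∫⁻ y in ball c r, g y ≤ maximal g x * volume (ball c r) := by
  have := le_maximal g hx
  rwa [ENNReal.div_le_iff (volume_ball_ne_zero c (pos_of_mem_ball hx))
    (volume_ball_ne_top c r)] at this

theorem measurable_maximal (g : (Fin n → ℝ) → ℝ≥0∞) : Measurable (maximal g) := by
  refine measurable_of_Ioi fun a => IsOpen.measurableSet ?_
  rw [isOpen_iff_mem_nhds]
  intro x hx
  obtain ⟨c, r, hr, hxc, h⟩ := lt_maximal_iff.1 hx
  filter_upwards [isOpen_ball.mem_nhds hxc] with y hy
  exact lt_maximal_iff.2 ⟨c, r, hr, hy, h⟩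

theorem maximal_mono_ae {g h : (Fin n → ℝ) → ℝ≥0∞} (H : ∀ᵐ x, g x ≤ h x) (x : Fin n → ℝ) :
    maximal g x ≤ maximal h x :=
  maximal_le fun _ _ _ hx => (ENNReal.div_le_div_right
    (lintegral_mono_ae (ae_restrict_of_ae H)) _).trans (le_maximal h hx)

theorem maximal_congr_ae {g h : (Fin n → ℝ) → ℝ≥0∞} (H : g =ᵐ[volume] h) :
    maximal g = maximal h :=
  funext fun x => le_antisymm (maximal_mono_ae H.le x) (maximal_mono_ae H.symm.le x)

theorem maximal_tsum_le {g : ℕ → (Fin n → ℝ) → ℝ≥0∞} (hg : ∀ k, AEMeasurable (g k))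
    (x : Fin n → ℝ) : maximal (fun y => ∑' k, g k y) x ≤ ∑' k, maximal (g k) x := by
  refine maximal_le fun c r hr hx => ?_
  rw [lintegral_tsum fun k => (hg k).restrict, div_eq_mul_inv, ← ENNReal.tsum_mul_right]
  exact ENNReal.tsum_le_tsum fun k => le_maximal (g k) hx

theorem maximal_const_mul (a : ℝ≥0∞) (ha : a ≠ ∞) (g : (Fin n → ℝ) → ℝ≥0∞) (x : Fin n → ℝ) :
    maximal (fun y => a * g y) x ≤ a * maximal g x := by
  refine maximal_le fun c r hr hx => ?_
  rw [lintegral_const_mul' _ _ ha, mul_div_assoc]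
  exact mul_le_mul_right (le_maximal g hx) a

end MaximalFunction

/-! ### Density sets and the local maximal function -/

section DensitySet

variable {n : ℕ}

/-- The set of points lying in a cube in which `E` has relative measure larger than `s`; it is
`{M χ_E > s}`. -/
def densitySet (s : ℝ) (E : Set (Fin n → ℝ)) : Set (Fin n → ℝ) :=
  {x | ∃ c r, 0 < r ∧ x ∈ ball c r ∧ ENNReal.ofReal s * volume (ball c r) < volume (ball c r ∩ E)}

theorem isOpen_densitySet (s : ℝ) (E : Set (Fin n → ℝ)) : IsOpen (densitySet s E) := by
  rw [isOpen_iff_mem_nhds]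
  rintro x ⟨c, r, hr, hx, h⟩
  filter_upwards [isOpen_ball.mem_nhds hx] with y hy
  exact ⟨c, r, hr, hy, h⟩

theorem densitySet_mono {s t : ℝ} (hst : s ≤ t) {E F : Set (Fin n → ℝ)} (hEF : E ⊆ F) :
    densitySet t E ⊆ densitySet s F := by
  rintro x ⟨c, r, hr, hx, h⟩
  exact ⟨c, r, hr, hx, (mul_le_mul_left (ENNReal.ofReal_le_ofReal hst) _).trans_lt
    (h.trans_le (measure_mono (inter_subset_inter_right _ hEF)))⟩

theorem ae_mem_densitySet {s : ℝ} (hs : s < 1) (E : Set (Fin n → ℝ)) :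
    ∀ᵐ x ∂(volume.restrict E), x ∈ densitySet s E := by
  filter_upwards [Besicovitch.ae_tendsto_measure_inter_div volume E] with x hx
  have h1 : ENNReal.ofReal s < 1 := by simpa using hs
  obtain ⟨r, hr, hr0⟩ := ((hx.eventually (lt_mem_nhds h1)).and self_mem_nhdsWithin).exists
  have hr0 : 0 < r := hr0
  refine ⟨x, r, hr0, mem_ball_self hr0, ?_⟩
  rw [ENNReal.lt_div_iff_mul_lt (Or.inl ?_) (Or.inl measure_closedBall_lt_top.ne),
    volume_closedBall_eq x x hr0] at hr
  · refine hr.trans_le (le_of_eq ?_)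
    rw [inter_comm]
    exact measure_congr ((closedBall_ae_eq_ball x hr0).inter (ae_eq_refl _))
  · rw [volume_closedBall_eq x x hr0]
    exact volume_ball_ne_zero x hr0

/-- The distribution function is right-continuous: {g > a} is the increasing union of {g > u_k} as
u_k decreases to a, so a strict inequality at a persists slightly above a. -/
theorem lt_rearrangement_iff {g : (Fin n → ℝ) → ℝ≥0∞} {a t : ℝ≥0∞} :
    a < rearrangement g t ↔ t < volume {x | a < g x} := by
  constructor
  · intro h
    by_contra! H
    obtain ⟨b, hab, hb⟩ := exists_between h
    refine hb.not_ge (sInf_le ⟨(zero_le).trans_lt hab, (measure_mono ?_).trans H⟩)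
    exact fun x (hx : b < g x) => hab.trans hx
  · intro h
    have ha : a < ∞ := by
      by_contra! H
      simp [top_le_iff.1 H] at h
    obtain ⟨u, hu, hua, hut⟩ := exists_seq_strictAnti_tendsto' ha
    have hU : {x | a < g x} = ⋃ k, {x | u k < g x} := by
      ext x
      simp only [mem_ofPred_eq, mem_iUnion]
      exact ⟨fun hx => ((hut.eventually (gt_mem_nhds hx)).exists),
        fun ⟨k, hk⟩ => (hua k).1.trans hk⟩
    have hmono : Monotone fun k => {x | u k < g x} :=
      fun i j hij x (hx : u i < g x) => (hu.antitone hij).trans_lt hx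
    rw [hU, hmono.measure_iUnion, lt_iSup_iff] at h
    obtain ⟨k, hk⟩ := h
    refine (hua k).1.trans_le (le_sInf fun b hb => ?_)
    by_contra! H
    exact hk.not_ge ((measure_mono fun x (hx : u k < g x) => H.trans hx).trans hb.2)

theorem lt_localMaximal_iff {s : ℝ} {g : (Fin n → ℝ) → ℝ≥0∞} {x : Fin n → ℝ} {a : ℝ≥0∞} :
    a < localMaximal s g x ↔ x ∈ densitySet s {y | a < g y} := by
  have key : ∀ Q : Set (Fin n → ℝ), {y | a < Q.indicator g y} = Q ∩ {y | a < g y} := by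
    intro Q
    ext y
    by_cases hy : y ∈ Q <;> simp [hy]
  simp only [localMaximal, lt_iSup_iff, lt_rearrangement_iff, key]
  constructor
  · rintro ⟨Q, hQ, hx, h⟩
    obtain ⟨c, r, hr, rfl⟩ := hQ.exists_ball
    exact ⟨c, r, hr, hx, h⟩
  · rintro ⟨c, r, hr, hx, h⟩
    exact ⟨_, isCube_ball c hr, hx, h⟩

theorem localMaximal_le_iff {s : ℝ} {g : (Fin n → ℝ) → ℝ≥0∞} {x : Fin n → ℝ} {a : ℝ≥0∞} :
    localMaximal s g x ≤ a ↔ x ∉ densitySet s {y | a < g y} := by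
  rw [← lt_localMaximal_iff, not_lt]

theorem measurable_localMaximal (s : ℝ) (g : (Fin n → ℝ) → ℝ≥0∞) :
    Measurable (localMaximal s g) := by
  refine measurable_of_Ioi fun a => ?_
  have : localMaximal s g ⁻¹' Ioi a = densitySet s {y | a < g y} := by
    ext x; exact lt_localMaximal_iff
  rw [this]
  exact (isOpen_densitySet _ _).measurableSet

theorem localMaximal_mono {s t : ℝ} (hst : s ≤ t) (g : (Fin n → ℝ) → ℝ≥0∞) (x : Fin n → ℝ) :
    localMaximal t g x ≤ localMaximal s g x := by
  refine le_of_forall_lt fun a ha => ?_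
  rw [lt_localMaximal_iff] at ha ⊢
  exact densitySet_mono hst Subset.rfl ha

theorem localMaximal_congr_ae (s : ℝ) {g h : (Fin n → ℝ) → ℝ≥0∞} (H : g =ᵐ[volume] h) :
    localMaximal s g = localMaximal s h := by
  have : ∀ {g h : (Fin n → ℝ) → ℝ≥0∞}, g =ᵐ[volume] h → ∀ x,
      localMaximal s g x ≤ localMaximal s h x := by
    intro g h H x
    refine le_of_forall_lt fun a ha => ?_
    rw [lt_localMaximal_iff] at ha ⊢
    obtain ⟨c, r, hr, hx, h1⟩ := ha
    refine ⟨c, r, hr, hx, h1.trans_le (measure_mono_ae ?_)⟩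
    filter_upwards [H] with y hy hy'
    exact ⟨hy'.1, (hy'.2 : a < g y).trans_eq hy⟩
  exact funext fun x => le_antisymm (this H x) (this H.symm x)

theorem localMaximal_const_mul (s : ℝ) {a : ℝ≥0∞} (ha0 : a ≠ 0) (ha : a ≠ ∞)
    (g : (Fin n → ℝ) → ℝ≥0∞) (x : Fin n → ℝ) :
    localMaximal s (fun y => a * g y) x = a * localMaximal s g x := by
  refine eq_of_forall_lt_iff fun b => ?_
  have h1 : ∀ z : ℝ≥0∞, b < a * z ↔ b / a < z := fun z => by
    rw [ENNReal.div_lt_iff (Or.inl ha0) (Or.inl ha), mul_comm]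
  rw [h1, lt_localMaximal_iff, lt_localMaximal_iff]
  simp only [h1]

end DensitySet

/-! ### Composition of density sets via Vitali coverings -/

section Vitali

variable {n : ℕ}

theorem exists_disjoint_cover {A : Set (Fin n → ℝ)} (c : (Fin n → ℝ) → (Fin n → ℝ))
    (r : (Fin n → ℝ) → ℝ) (R : ℝ) (hr : ∀ x ∈ A, 0 < r x) (hR : ∀ x ∈ A, r x ≤ R)
    (hc : ∀ x ∈ A, x ∈ closedBall (c x) (r x)) :
    ∃ u ⊆ A, u.Countable ∧ (u.PairwiseDisjoint fun b => ball (c b) (r b)) ∧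
      A ⊆ ⋃ b ∈ u, closedBall (c b) (5 * r b) := by
  obtain ⟨u, huA, hd, hcov⟩ := Vitali.exists_disjoint_subfamily_covering_enlargement_closedBall
    A c r R hR 5 (by norm_num)
  refine ⟨u, huA, ?_, ?_, ?_⟩
  · refine hd.countable_of_nonempty_interior fun b hb => ⟨c b, ?_⟩
    exact ball_subset_interior_closedBall (mem_ball_self (hr b (huA hb)))
  · exact hd.mono fun b => ball_subset_closedBall
  · intro x hx
    obtain ⟨b, hb, hsub⟩ := hcov x hx
    exact mem_iUnion₂.2 ⟨b, hb, hsub (hc x hx)⟩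

/-- Let Q be a cube in which the inner density set is s-dense, and attach to each of its points in Q
a cube where E is t-dense. If one of these is at least as large as Q, its triple contains the given
point. Otherwise all lie in 3Q, and a disjoint Vitali subfamily gives t·s|Q| < 5^n |3Q ∩ E|; passing
from Q to 3Q costs another 3^n. -/
theorem densitySet_comp {s t : ℝ} (hs : 0 < s) (hs1 : s ≤ 1) (ht : 0 < t)
    (E : Set (Fin n → ℝ)) :
    densitySet s (densitySet t E) ⊆ densitySet ((1 / 15) ^ n * (s * t)) E := by
  rintro x ⟨c, r, hr, hx, h⟩
  set A := ball c r ∩ densitySet t E with hA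
  have hch : ∀ y : Fin n → ℝ, ∃ c' : Fin n → ℝ, ∃ r' : ℝ, y ∈ A → 0 < r' ∧ y ∈ ball c' r' ∧
      ENNReal.ofReal t * volume (ball c' r') < volume (ball c' r' ∩ E) := by
    intro y
    by_cases hy : y ∈ A
    · obtain ⟨c', r', h1, h2, h3⟩ := hy.2
      exact ⟨c', r', fun _ => ⟨h1, h2, h3⟩⟩
    · exact ⟨0, 0, fun h => absurd h hy⟩
  choose c' r' hcr using hch
  by_cases hbig : ∃ y ∈ A, r ≤ r' y
  · obtain ⟨y, hy, hry⟩ := hbig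
    obtain ⟨h1, h2, h3⟩ := hcr y hy
    have h2' : dist y (c' y) < r' y := h2
    have h4 : dist x (c' y) ≤ dist x c + dist c y + dist y (c' y) := dist_triangle4 _ _ _ _
    have h5 : dist x c < r := hx
    have h6 : dist c y < r := by rw [dist_comm]; exact hy.1
    refine ⟨c' y, 3 * r' y, by positivity, by rw [mem_ball]; linarith, ?_⟩
    refine lt_of_le_of_lt ?_ (h3.trans_le (measure_mono (inter_subset_inter_left _
      (ball_subset_ball (by linarith)))))
    rw [volume_ball_mul (c' y) (c' y) (by norm_num) h1, ← mul_assoc]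
    refine mul_le_mul_left ?_ _
    rw [← ENNReal.ofReal_pow (by norm_num), ← ENNReal.ofReal_mul (by positivity)]
    refine ENNReal.ofReal_le_ofReal ?_
    have : (1 / 15 : ℝ) ^ n * (s * t) * 3 ^ n = (1 / 5) ^ n * (s * t) := by
      rw [mul_right_comm, ← mul_pow]; norm_num
    rw [this]
    have h7 : (1 / 5 : ℝ) ^ n ≤ 1 := pow_le_one₀ (by norm_num) (by norm_num)
    have h8 : s * t ≤ t := by nlinarith
    nlinarith [mul_pos hs ht]
  · push Not at hbig
    obtain ⟨u, huA, huc, hud, hucov⟩ := exists_disjoint_cover c' r' r (fun y hy => (hcr y hy).1)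
      (fun y hy => (hbig y hy).le) (fun y hy => ball_subset_closedBall (hcr y hy).2.1)
    refine ⟨c, 3 * r, by positivity, ball_subset_ball (by linarith) hx, ?_⟩
    have hsub : ∀ b ∈ u, ball (c' b) (r' b) ⊆ ball c (3 * r) := by
      intro b hb
      have h1 := hbig b (huA hb)
      have h2 : dist b (c' b) < r' b := (hcr b (huA hb)).2.1
      have h3 : dist b c < r := (huA hb).1
      rw [dist_comm] at h2
      refine ball_subset_ball' ?_
      linarith [dist_triangle (c' b) b c]
    have h1 : ENNReal.ofReal t * volume A ≤ ENNReal.ofReal 5 ^ n * volume (ball c (3 * r) ∩ E) :=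
      calc ENNReal.ofReal t * volume A
          ≤ ENNReal.ofReal t * ∑' b : u, volume (closedBall (c' b) (5 * r' b)) := by
            gcongr
            exact (measure_mono hucov).trans (measure_biUnion_le _ huc _)
        _ = ∑' b : u, ENNReal.ofReal 5 ^ n *
              (ENNReal.ofReal t * volume (ball (c' (b : Fin n → ℝ)) (r' b))) := by
            rw [← ENNReal.tsum_mul_left]
            refine tsum_congr fun b => ?_
            have hb := (hcr b (huA b.2)).1
            rw [volume_closedBall_eq _ (c' b) (by positivity),
              volume_ball_mul (c' b) (c' b) (by norm_num) hb]
            ring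
        _ ≤ ∑' b : u, ENNReal.ofReal 5 ^ n * volume.restrict E (ball (c' b) (r' b)) := by
            refine ENNReal.tsum_le_tsum fun b => ?_
            gcongr
            rw [Measure.restrict_apply measurableSet_ball]
            exact (hcr b (huA b.2)).2.2.le
        _ = ENNReal.ofReal 5 ^ n * volume.restrict E (⋃ b ∈ u, ball (c' b) (r' b)) := by
            rw [ENNReal.tsum_mul_left, measure_biUnion huc hud fun _ _ => measurableSet_ball]
        _ ≤ ENNReal.ofReal 5 ^ n * volume (ball c (3 * r) ∩ E) := by
            rw [← Measure.restrict_apply measurableSet_ball]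
            gcongr
            exact iUnion₂_subset hsub
    have h2 : ENNReal.ofReal t * (ENNReal.ofReal s * volume (ball c r)) <
        ENNReal.ofReal 5 ^ n * volume (ball c (3 * r) ∩ E) :=
      (ENNReal.mul_lt_mul_right (by simpa using ht) ENNReal.ofReal_ne_top h).trans_le h1
    rw [volume_ball_mul c c (by norm_num) hr]
    have h5 : ENNReal.ofReal 5 ^ n ≠ 0 := by positivity
    have h5' : ENNReal.ofReal 5 ^ n ≠ ∞ := ENNReal.pow_ne_top ENNReal.ofReal_ne_top
    rw [← ENNReal.mul_lt_mul_iff_right h5 h5']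
    refine lt_of_le_of_lt (le_of_eq ?_) h2
    have : ENNReal.ofReal 5 ^ n * ENNReal.ofReal ((1 / 15) ^ n * (s * t)) * ENNReal.ofReal 3 ^ n
        = ENNReal.ofReal t * ENNReal.ofReal s := by
      rw [← ENNReal.ofReal_pow (by norm_num), ← ENNReal.ofReal_pow (by norm_num),
        ← ENNReal.ofReal_mul (by positivity), ← ENNReal.ofReal_mul (by positivity),
        ← ENNReal.ofReal_mul ht.le]
      congr 1
      have : (5 : ℝ) ^ n * (1 / 15) ^ n * 3 ^ n = 1 := by
        rw [← mul_pow, ← mul_pow]; norm_num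
      linear_combination (s * t) * this
    rw [← mul_assoc (ENNReal.ofReal t), ← this]
    ring

theorem localMaximal_comp_le {s t : ℝ} (hs : 0 < s) (hs1 : s ≤ 1) (ht : 0 < t)
    (g : (Fin n → ℝ) → ℝ≥0∞) (x : Fin n → ℝ) :
    localMaximal s (localMaximal t g) x ≤ localMaximal ((1 / 15) ^ n * (s * t)) g x := by
  refine le_of_forall_lt fun a ha => ?_
  rw [lt_localMaximal_iff] at ha ⊢
  simp only [lt_localMaximal_iff] at ha
  exact densitySet_comp hs hs1 ht _ ha

end Vitali

/-! ### Stopping cubes and the reverse weak type inequality -/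

section StoppingBalls

variable {n : ℕ}

/-- In positive dimension r ≤ (2r)^n for r > 1, so a cube with average above t has radius at most 1
or at most ‖g‖₁/t. In dimension zero volumes do not grow and this fails. -/
theorem exists_radius_bound (hn : 0 < n) {g : (Fin n → ℝ) → ℝ≥0∞} (hg : ∫⁻ y, g y ≠ ∞)
    {t : ℝ≥0∞} (ht : t ≠ 0) : ∃ R : ℝ, ∀ (x : Fin n → ℝ) (r : ℝ), 0 < r →
      t * volume (ball x r) < ∫⁻ y in ball x r, g y → r ≤ R := by
  refine ⟨max 1 ((∫⁻ y, g y) / t).toReal, fun x r hr h => ?_⟩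
  by_contra! hR
  have h1 : 1 < r := (le_max_left _ _).trans_lt hR
  have h2 : r ≤ (2 * r) ^ n := by
    have := le_self_pow₀ (a := 2 * r) (by linarith) hn.ne'
    linarith
  have h3 : t * ENNReal.ofReal r < ∫⁻ y, g y := by
    refine lt_of_le_of_lt ?_ (h.trans_le (setLIntegral_le_lintegral _ _))
    rw [volume_ball_eq x hr]
    gcongr
  have hfin : (∫⁻ y, g y) / t ≠ ∞ := ENNReal.div_ne_top hg ht
  have h4 : ENNReal.ofReal r ≤ (∫⁻ y, g y) / t := by
    rw [ENNReal.le_div_iff_mul_le (Or.inl ht) (Or.inr hg), mul_comm]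
    exact h3.le
  have h5 := (ENNReal.ofReal_le_iff_le_toReal hfin).1 h4
  exact absurd ((le_max_right _ _).trans_lt hR) (not_lt.2 h5)

/-- Any admissible radius larger than half the supremum of the admissible radii works: twice it
already exceeds the supremum. -/
theorem exists_stopping_radius (hn : 0 < n) {g : (Fin n → ℝ) → ℝ≥0∞} (hg : ∫⁻ y, g y ≠ ∞)
    {t : ℝ≥0∞} (ht : t ≠ 0) {x : Fin n → ℝ}
    (h : ∃ r, 0 < r ∧ t * volume (ball x r) < ∫⁻ y in ball x r, g y) :
    ∃ r, 0 < r ∧ t * volume (ball x r) < ∫⁻ y in ball x r, g y ∧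
      ∀ r', 2 * r ≤ r' → ∫⁻ y in ball x r', g y ≤ t * volume (ball x r') := by
  obtain ⟨R, hR⟩ := exists_radius_bound hn hg ht
  set S := {r : ℝ | 0 < r ∧ t * volume (ball x r) < ∫⁻ y in ball x r, g y} with hS
  have hbdd : BddAbove S := ⟨R, fun r hr => hR x r hr.1 hr.2⟩
  obtain ⟨r₀, hr₀⟩ : S.Nonempty := h
  have hpos : 0 < sSup S := hr₀.1.trans_le (le_csSup hbdd hr₀)
  obtain ⟨r, hr, hlt⟩ := exists_lt_of_lt_csSup ⟨r₀, hr₀⟩ (half_lt_self hpos)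
  refine ⟨r, hr.1, hr.2, fun r' hr' => ?_⟩
  by_contra! hcon
  have : r' ≤ sSup S := le_csSup hbdd ⟨by linarith [hr.1], hcon⟩
  linarith

theorem ae_exists_ball_average_gt {g : (Fin n → ℝ) → ℝ≥0∞} (hg : Measurable g)
    (hgi : ∫⁻ y, g y ≠ ∞) (t : ℝ≥0∞) :
    ∀ᵐ x, t < g x → ∃ r, 0 < r ∧ t * volume (ball x r) < ∫⁻ y in ball x r, g y := by
  filter_upwards [(Besicovitch.vitaliFamily
    (volume : Measure (Fin n → ℝ))).ae_tendsto_lintegral_div' hg hgi] with x hx htx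
  have h1 := hx.comp (Besicovitch.tendsto_filterAt volume x)
  obtain ⟨r, hr, hr0⟩ := ((h1.eventually (lt_mem_nhds htx)).and self_mem_nhdsWithin).exists
  have hr0 : 0 < r := hr0
  refine ⟨r, hr0, ?_⟩
  have hr : t < (∫⁻ y in closedBall x r, g y) / volume (closedBall x r) := hr
  rwa [setLIntegral_closedBall g x hr0, volume_closedBall_eq x x hr0,
    ENNReal.lt_div_iff_mul_lt (Or.inl (volume_ball_ne_zero x hr0))
      (Or.inl (volume_ball_ne_top x r))] at hr

/-- The reverse weak type inequality for the maximal operator on a cube. -/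
theorem setLIntegral_gt_le_volume_maximal_gt (hn : 0 < n) {W : (Fin n → ℝ) → ℝ≥0∞}
    (hW : Measurable W) {c : Fin n → ℝ} {l : ℝ} (hl : 0 < l)
    (hfin : ∫⁻ x in ball c l, W x ≠ ∞) {t : ℝ≥0∞} (ht : t ≠ 0)
    (havg : ∫⁻ x in ball c l, W x ≤ t * volume (ball c l)) :
    ∫⁻ x in ball c l ∩ {x | t < W x}, W x ≤
      10 ^ n * (t * volume (ball c l ∩ {x | t < maximal ((ball c l).indicator W) x})) := by
  set f := (ball c l).indicator W with hf
  have hfm : Measurable f := hW.indicator measurableSet_ball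
  have hfi : ∫⁻ y, f y = ∫⁻ x in ball c l, W x := lintegral_indicator measurableSet_ball _
  have hfi' : ∫⁻ y, f y ≠ ∞ := hfi ▸ hfin
  set A := {x | x ∈ ball c l ∧ ∃ r, 0 < r ∧ t * volume (ball x r) < ∫⁻ y in ball x r, f y}
  have hch : ∀ x : Fin n → ℝ, ∃ r : ℝ, x ∈ A → 0 < r ∧
      t * volume (ball x r) < ∫⁻ y in ball x r, f y ∧
      ∀ r', 2 * r ≤ r' → ∫⁻ y in ball x r', f y ≤ t * volume (ball x r') := by
    intro x
    by_cases hx : x ∈ A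
    · obtain ⟨r, hr⟩ := exists_stopping_radius hn hfi' ht hx.2
      exact ⟨r, fun _ => hr⟩
    · exact ⟨0, fun h => absurd h hx⟩
  choose r hr using hch
  -- A larger stopping cube would have at least the volume of the given cube, whose average is at
  -- most t.
  have hrl : ∀ x ∈ A, r x ≤ l := by
    intro x hx
    by_contra! hcon
    refine (hr x hx).2.1.not_ge ?_
    refine (setLIntegral_le_lintegral _ _).trans (hfi.le.trans (havg.trans ?_))
    rw [volume_ball_eq c hl, volume_ball_eq x (hr x hx).1]
    gcongr
  obtain ⟨u, huA, huc, hud, hucov⟩ := exists_disjoint_cover id r l (fun x hx => (hr x hx).1)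
    hrl (fun x hx => mem_closedBall_self (hr x hx).1.le)
  simp only [id] at hud hucov
  have : Countable u := huc.to_subtype
  have hsub : (ball c l ∩ {x | t < W x} : Set (Fin n → ℝ)) ≤ᵐ[volume]
      (⋃ b : u, closedBall (b : Fin n → ℝ) (5 * r b) : Set (Fin n → ℝ)) := by
    filter_upwards [ae_exists_ball_average_gt hfm hfi' t] with x hx hxm
    have hfx : f x = W x := indicator_of_mem hxm.1 _
    have hxA : x ∈ A := ⟨hxm.1, hx (hfx ▸ hxm.2)⟩
    have h2 := hucov hxA
    rw [biUnion_eq_iUnion] at h2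
    exact h2
  calc ∫⁻ x in ball c l ∩ {x | t < W x}, W x
      = ∫⁻ x in ball c l ∩ {x | t < W x}, f x := by
        refine setLIntegral_congr_fun (measurableSet_ball.inter
          (measurableSet_lt measurable_const hW)) fun x hx => ?_
        exact (indicator_of_mem hx.1 _).symm
    _ ≤ ∫⁻ x in ⋃ b : u, closedBall (b : Fin n → ℝ) (5 * r b), f x := lintegral_mono_set' hsub
    _ ≤ ∑' b : u, ∫⁻ x in closedBall (b : Fin n → ℝ) (5 * r b), f x := lintegral_iUnion_le _ _
    -- Since 5r ≥ 2r, the average over the fivefold cube is at most t. A cube of radius r/2 fits in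
    -- the stopping cube and the ambient one, and 5r = 10·(r/2).
    _ ≤ ∑' b : u, 10 ^ n * (t * volume (ball (b : Fin n → ℝ) (r b) ∩ ball c l)) := by
        refine ENNReal.tsum_le_tsum fun b => ?_
        obtain ⟨h1, -, h3⟩ := hr b (huA b.2)
        obtain ⟨c', hc'⟩ := exists_ball_subset_inter h1 (hrl b (huA b.2)) (huA b.2).1
        rw [setLIntegral_closedBall _ _ (by positivity)]
        refine (h3 _ (by linarith)).trans ?_
        have h4 : 5 * r b = 10 * (r b / 2) := by ring
        rw [h4, volume_ball_mul (b : Fin n → ℝ) c' (by norm_num) (half_pos h1), mul_left_comm]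
        have h10 : ENNReal.ofReal 10 = 10 := by norm_num
        rw [h10]
        gcongr
    _ = 10 ^ n * (t * volume (⋃ b ∈ u, ball (b : Fin n → ℝ) (r b) ∩ ball c l)) := by
        rw [ENNReal.tsum_mul_left, ENNReal.tsum_mul_left, measure_biUnion huc]
        · exact hud.mono fun b => inter_subset_left
        · exact fun _ _ => measurableSet_ball.inter measurableSet_ball
    _ ≤ _ := by
        gcongr
        refine iUnion₂_subset fun b hb x hx => ⟨hx.2, ?_⟩
        obtain ⟨h1, h2, -⟩ := hr b (huA hb)
        refine lt_maximal_iff.2 ⟨b, r b, h1, hx.1, ?_⟩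
        rwa [ENNReal.lt_div_iff_mul_lt (Or.inl (volume_ball_ne_zero b h1))
          (Or.inl (volume_ball_ne_top b _))]

end StoppingBalls

/-! ### Absolute continuity of Fujii–Wilson weights -/

section FujiiWilson

variable {n : ℕ}

/-- The Fujii–Wilson `A_∞` condition with constant `C` for a locally integrable density. -/
def FujiiWilson (C : ℝ≥0∞) (W : (Fin n → ℝ) → ℝ≥0∞) : Prop :=
  ∀ (c : Fin n → ℝ) (r : ℝ), 0 < r → ∫⁻ x in ball c r, W x ≠ ∞ ∧
    ∫⁻ x in ball c r, maximal ((ball c r).indicator W) x ≤ C * ∫⁻ x in ball c r, W x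

/-- The geometric sum is at most twice its last nonzero term, which is below m. -/
theorem sum_dyadic_levels_le (a m : ℝ≥0∞) (J : ℕ) :
    ∑ j ∈ Finset.range J, (if 2 ^ j * a < m then 2 ^ j * a else 0) ≤ 2 * m := by
  have hgeom : ∀ J : ℕ, ∑ j ∈ Finset.range J, 2 ^ j * a ≤ 2 ^ J * a := by
    intro J
    induction J with
    | zero => simp
    | succ J ih =>
      rw [Finset.sum_range_succ, pow_succ, mul_assoc, two_mul, mul_add]
      gcongr
  induction J with
  | zero => simp
  | succ J ih =>
    by_cases h : 2 ^ J * a < m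
    · refine (Finset.sum_le_sum fun j _ => ?_).trans ((hgeom (J + 1)).trans ?_)
      · split_ifs
        · exact le_rfl
        · exact zero_le
      · rw [pow_succ, mul_comm _ (2 : ℝ≥0∞), mul_assoc]
        gcongr
    · rw [Finset.sum_range_succ, if_neg h, add_zero]
      exact ih

/-- The tail above 2^J a is below the tail above each 2^j a with j < J. Adding the J reverse weak
type bounds reconstructs at most twice the integral of the maximal function, so the tail is a
fraction O(C/J) of the mass. -/
theorem FujiiWilson.mul_setLIntegral_gt_le (hn : 0 < n) {C : ℝ≥0∞} {W : (Fin n → ℝ) → ℝ≥0∞}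
    (hW : Measurable W) (hC : FujiiWilson C W) {c : Fin n → ℝ} {l : ℝ} (hl : 0 < l)
    {a : ℝ≥0∞} (ha : a ≠ 0) (havg : ∫⁻ x in ball c l, W x = a * volume (ball c l)) (J : ℕ) :
    J * ∫⁻ x in ball c l ∩ {x | 2 ^ J * a < W x}, W x ≤
      10 ^ n * (2 * (C * ∫⁻ x in ball c l, W x)) := by
  obtain ⟨hfin, hFW⟩ := hC c l hl
  set m := maximal ((ball c l).indicator W)
  have hm : Measurable m := measurable_maximal _
  have hlevel : ∀ t : ℝ≥0∞, MeasurableSet {x | t < m x} := fun t =>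
    measurableSet_lt measurable_const hm
  calc (J : ℝ≥0∞) * ∫⁻ x in ball c l ∩ {x | 2 ^ J * a < W x}, W x
      = ∑ j ∈ Finset.range J, ∫⁻ x in ball c l ∩ {x | 2 ^ J * a < W x}, W x := by simp
    _ ≤ ∑ j ∈ Finset.range J,
          10 ^ n * (2 ^ j * a * volume (ball c l ∩ {x | 2 ^ j * a < m x})) := by
        refine Finset.sum_le_sum fun j hj => ?_
        have h2 : (1 : ℝ≥0∞) ≤ 2 := one_le_two
        refine le_trans (lintegral_mono_set ?_) (setLIntegral_gt_le_volume_maximal_gt hn hW hl hfin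
          (mul_ne_zero (by positivity) ha) ?_)
        · refine inter_subset_inter_right _ fun x (hx : 2 ^ J * a < W x) =>
            show 2 ^ j * a < W x from lt_of_le_of_lt ?_ hx
          gcongr
          exact (Finset.mem_range.1 hj).le
        · rw [havg]
          gcongr
          exact le_mul_of_one_le_left zero_le (one_le_pow₀ h2)
    _ = 10 ^ n * ∑ j ∈ Finset.range J,
          ∫⁻ x in ball c l, (if 2 ^ j * a < m x then 2 ^ j * a else 0) := by
        rw [Finset.mul_sum]
        refine Finset.sum_congr rfl fun j _ => ?_
        congr 1
        have : (fun x => if 2 ^ j * a < m x then 2 ^ j * a else 0) =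
            {x | 2 ^ j * a < m x}.indicator fun _ => 2 ^ j * a := by
          ext x; simp [indicator]
        rw [this, lintegral_indicator_const (hlevel _), Measure.restrict_apply (hlevel _),
          inter_comm]
    _ = 10 ^ n * ∫⁻ x in ball c l, ∑ j ∈ Finset.range J,
          (if 2 ^ j * a < m x then 2 ^ j * a else 0) := by
        rw [lintegral_finsetSum]
        exact fun j _ => Measurable.ite (hlevel _) measurable_const measurable_const
    _ ≤ 10 ^ n * ∫⁻ x in ball c l, 2 * m x := by
        gcongr with x
        exact sum_dyadic_levels_le _ _ _
    _ ≤ _ := by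
        rw [lintegral_const_mul _ hm]
        gcongr

/-- Quantitative absolute continuity of `A_∞` weights on cubes. -/
theorem exists_small_of_fujiiWilson (hn : 0 < n) (C : ℝ≥0) {η : ℝ≥0} (hη : 0 < η) :
    ∃ ε : ℝ, 0 < ε ∧ ε < 1 ∧ ∀ W : (Fin n → ℝ) → ℝ≥0∞, Measurable W → FujiiWilson C W →
      ∀ (c : Fin n → ℝ) (l : ℝ), 0 < l → ∀ E ⊆ ball c l,
        volume E ≤ ENNReal.ofReal ε * volume (ball c l) →
        ∫⁻ x in E, W x ≤ η * ∫⁻ x in ball c l, W x := by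
  -- J makes the tail above 2^J times the average at most η/2 of the mass; the summand 1 keeps J
  -- nonzero.
  obtain ⟨J, hJ⟩ := exists_nat_ge (4 * 10 ^ n * C / η + 1)
  have hJ1 : (1 : ℝ≥0) ≤ J := le_trans (by simp) hJ
  have hJ0 : (J : ℝ≥0∞) ≠ 0 := by
    have : J ≠ 0 := by rintro rfl; simp at hJ1
    exact_mod_cast this
  have hJη : 4 * 10 ^ n * C ≤ η * J := by
    have : 4 * 10 ^ n * C / η ≤ J := le_trans (by simp) hJ
    rw [mul_comm η]
    exact (div_le_iff₀ hη).1 this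
  have hη' : (0 : ℝ) < η := hη
  -- Where W ≤ 2^J a, the contribution is at most 2^J a · ε|Q|, which is η/2 of the mass for ε =
  -- η/2^(J+1).
  refine ⟨min (1 / 2) (η / 2 ^ (J + 1)), by positivity, (min_le_left _ _).trans_lt (by norm_num),
    fun W hW hFW c l hl E hE hvol => ?_⟩
  obtain ⟨hfin, -⟩ := hFW c l hl
  set I := ∫⁻ x in ball c l, W x with hI
  by_cases hI0 : I = 0
  · exact ((lintegral_mono_set hE).trans hI0.le).trans zero_le
  have hv0 := volume_ball_ne_zero c hl
  have hvt := volume_ball_ne_top c l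
  set a := I / volume (ball c l) with ha
  have ha0 : a ≠ 0 := (ENNReal.div_pos hI0 hvt).ne'
  have haI : I = a * volume (ball c l) := (ENNReal.div_mul_cancel hv0 hvt).symm
  set T := 2 ^ J * a with hT
  have hbig : ∫⁻ x in ball c l ∩ {x | T < W x}, W x ≤ η / 2 * I := by
    have h1 := hFW.mul_setLIntegral_gt_le hn hW hl ha0 haI J
    rw [← ENNReal.mul_le_mul_iff_right hJ0 (ENNReal.natCast_ne_top J)]
    refine h1.trans ?_
    have h2 : (4 * 10 ^ n * C : ℝ≥0∞) ≤ η * J := by exact_mod_cast hJη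
    have h3 : 2 * (10 ^ n * (2 * (C * I))) = (4 * 10 ^ n * C) * I := by ring
    have h4 : 2 * ((J : ℝ≥0∞) * (η / 2 * I)) = (η * J) * I := by
      have : (2 : ℝ≥0∞) * (η / 2) = η := ENNReal.mul_div_cancel (by norm_num) (by norm_num)
      calc 2 * ((J : ℝ≥0∞) * (η / 2 * I)) = (2 * (η / 2)) * J * I := by ring
        _ = _ := by rw [this]
    rw [← ENNReal.mul_le_mul_iff_right (a := 2) (by norm_num) (by norm_num), h3, h4]
    gcongr
  have hsmall : ∫⁻ x in E ∩ {x | W x ≤ T}, W x ≤ η / 2 * I := by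
    calc ∫⁻ x in E ∩ {x | W x ≤ T}, W x ≤ ∫⁻ x in E ∩ {x | W x ≤ T}, T :=
          setLIntegral_mono measurable_const fun x hx => hx.2
      _ = T * volume (E ∩ {x | W x ≤ T}) := setLIntegral_const _ _
      _ ≤ T * (ENNReal.ofReal (η / 2 ^ (J + 1)) * volume (ball c l)) := by
          gcongr
          exact (measure_mono inter_subset_left).trans (hvol.trans (by
            gcongr; exact min_le_right _ _))
      _ = η / 2 * I := by
          have h2J : (2 : ℝ≥0∞) ^ J ≠ 0 := by positivity
          have h2J' : (2 : ℝ≥0∞) ^ J ≠ ∞ := ENNReal.pow_ne_top (by norm_num)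
          have : ENNReal.ofReal (η / 2 ^ (J + 1)) = η / 2 / 2 ^ J := by
            rw [pow_succ', ← div_div, ENNReal.ofReal_div_of_pos (by positivity),
              ENNReal.ofReal_div_of_pos (by positivity), ENNReal.ofReal_pow (by norm_num)]
            simp
          rw [this, hT, haI]
          calc 2 ^ J * a * (η / 2 / 2 ^ J * volume (ball c l))
              = (2 ^ J * (η / 2 / 2 ^ J)) * (a * volume (ball c l)) := by ring
            _ = _ := by rw [ENNReal.mul_div_cancel h2J h2J']
  calc ∫⁻ x in E, W x
      ≤ ∫⁻ x in (E ∩ {x | W x ≤ T}) ∪ (ball c l ∩ {x | T < W x}), W x := by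
        refine lintegral_mono_set fun x hx => ?_
        rcases le_or_gt (W x) T with h | h
        · exact Or.inl ⟨hx, h⟩
        · exact Or.inr ⟨hE hx, h⟩
    _ ≤ η / 2 * I + η / 2 * I := (lintegral_union_le _ _ _).trans (add_le_add hsmall hbig)
    _ = η * I := by rw [← add_mul, ENNReal.add_halves]

end FujiiWilson

/-! ### Doubling of weighted mass on density sets -/

section DensityIteration

variable {n : ℕ}

/-- At twice the stopping radius E has density at most ε, so it carries a fraction at most η of the
mass of W there. Its density there still exceeds ε/2^n, so the cube lies in the density set.
Besicovitch splits a cover into N disjoint families, whence W(E) ≤ ηN·W(density set). -/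
theorem exists_setLIntegral_le_half_densitySet (hn : 0 < n) (C : ℝ≥0) :
    ∃ s : ℝ, 0 < s ∧ s < 1 ∧ ∀ W : (Fin n → ℝ) → ℝ≥0∞, Measurable W → FujiiWilson C W →
      ∀ E, MeasurableSet E → volume E ≠ ∞ →
        2 * ∫⁻ x in E, W x ≤ ∫⁻ x in densitySet s E, W x := by
  obtain ⟨N, τ, hτ, hN⟩ := HasBesicovitchCovering.no_satelliteConfig (α := Fin n → ℝ)
  -- This makes 2ηN = N/(N+1) ≤ 1, with no case distinction for N = 0.
  have hη : (0 : ℝ≥0) < 1 / (2 * (N + 1)) := by positivity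
  obtain ⟨ε, hε, hε1, H⟩ := exists_small_of_fujiiWilson hn C hη
  refine ⟨(1 / 2) ^ n * ε, by positivity, ?_, fun W hW hFW E hE hEfin => ?_⟩
  · exact (mul_le_of_le_one_left hε.le (pow_le_one₀ (by norm_num) (by norm_num))).trans_lt hε1
  set t := ENNReal.ofReal ε with ht
  have ht0 : t ≠ 0 := by simpa [ht] using hε
  set g : (Fin n → ℝ) → ℝ≥0∞ := E.indicator 1 with hg
  have hgm : Measurable g := measurable_one.indicator hE
  have hgi : ∀ A : Set (Fin n → ℝ), ∫⁻ y in A, g y = volume (A ∩ E) := by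
    intro A
    rw [hg, lintegral_indicator_one hE, Measure.restrict_apply hE, inter_comm]
  have hgfin : ∫⁻ y, g y ≠ ∞ := by
    rwa [hg, lintegral_indicator_one hE]
  set A := {x | x ∈ E ∧ ∃ r, 0 < r ∧ t * volume (ball x r) < ∫⁻ y in ball x r, g y}
  have hEA : E ≤ᵐ[volume] A := by
    filter_upwards [ae_exists_ball_average_gt hgm hgfin t] with x hx hxE
    refine ⟨hxE, hx ?_⟩
    have : g x = 1 := indicator_of_mem hxE _
    rw [this, ht]
    simpa using hε1
  choose r hr using fun x : A => exists_stopping_radius hn hgfin ht0 x.2.2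
  obtain ⟨R, hR⟩ := exists_radius_bound hn hgfin ht0
  let q : Besicovitch.BallPackage A (Fin n → ℝ) :=
    { c := Subtype.val
      r := fun x => 2 * r x
      rpos := fun x => by linarith [(hr x).1]
      r_bound := 2 * R
      r_le := fun x => by linarith [hR x (r x) (hr x).1 (hr x).2.1] }
  obtain ⟨S, hSd, hScov⟩ := Besicovitch.exist_disjoint_covering_families hτ hN q
  have hball : ∀ x : A, ∫⁻ y in E ∩ ball (x : Fin n → ℝ) (2 * r x), W y ≤
      (1 / (2 * (N + 1)) : ℝ≥0) * ∫⁻ y in ball (x : Fin n → ℝ) (2 * r x), W y := by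
    intro x
    refine H W hW hFW x _ (q.rpos x) _ inter_subset_right ?_
    have := (hr x).2.2 (2 * r x) le_rfl
    rwa [hgi, inter_comm] at this
  have hdens : ∀ x : A, ball (x : Fin n → ℝ) (2 * r x) ⊆ densitySet ((1 / 2) ^ n * ε) E := by
    intro x y hy
    refine ⟨x, 2 * r x, q.rpos x, hy, ?_⟩
    have h1 := (hr x).2.1
    rw [hgi] at h1
    refine lt_of_le_of_lt (le_of_eq ?_) (h1.trans_le (measure_mono (inter_subset_inter_left _
      (ball_subset_ball (by linarith [(hr x).1])))))
    rw [volume_ball_mul (x : Fin n → ℝ) x (by norm_num) (hr x).1, ← mul_assoc,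
      ← ENNReal.ofReal_pow (by norm_num), ← ENNReal.ofReal_mul (by positivity), ht]
    congr 2
    have : (1 / 2 : ℝ) ^ n * 2 ^ n = 1 := by rw [← mul_pow]; norm_num
    linear_combination ε * this
  have hcount : ∀ i, (S i).Countable := fun i =>
    (hSd i).countable_of_nonempty_interior fun x _ => ⟨x,
      ball_subset_interior_closedBall (mem_ball_self (q.rpos x))⟩
  have hfam : ∀ i, ∑' x : S i, ∫⁻ y in ball ((x : A) : Fin n → ℝ) (2 * r x), W y ≤
      ∫⁻ y in densitySet ((1 / 2) ^ n * ε) E, W y := by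
    intro i
    have : Countable (S i) := (hcount i).to_subtype
    rw [← lintegral_iUnion (fun _ => measurableSet_ball)]
    · exact lintegral_mono_set (iUnion_subset fun x => hdens x)
    · intro x y hxy
      exact (hSd i x.2 y.2 (by simpa [Subtype.ext_iff] using hxy)).mono ball_subset_closedBall
        ball_subset_closedBall
  have hmain : ∫⁻ x in E, W x ≤ (1 / (2 * (N + 1)) : ℝ≥0) * (N *
      ∫⁻ y in densitySet ((1 / 2) ^ n * ε) E, W y) := by
    calc ∫⁻ x in E, W x
        ≤ ∫⁻ x in ⋃ i : Fin N, ⋃ x : S i, E ∩ ball ((x : A) : Fin n → ℝ) (2 * r x), W x := by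
          refine lintegral_mono_set' ?_
          filter_upwards [hEA] with x hx hxE
          have hxA : x ∈ A := hx hxE
          obtain ⟨i, hi⟩ := mem_iUnion.1 (hScov ⟨⟨x, hxA⟩, rfl⟩)
          obtain ⟨j, hj, hxj⟩ := mem_iUnion₂.1 hi
          exact mem_iUnion.2 ⟨i, mem_iUnion.2 ⟨⟨j, hj⟩, hxE, hxj⟩⟩
      _ ≤ ∑' i : Fin N, ∑' x : S i, ∫⁻ y in E ∩ ball ((x : A) : Fin n → ℝ) (2 * r x), W y := by
          refine (lintegral_iUnion_le _ _).trans (ENNReal.tsum_le_tsum fun i => ?_)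
          have : Countable (S i) := (hcount i).to_subtype
          exact lintegral_iUnion_le _ _
      _ ≤ ∑' _i : Fin N, (1 / (2 * (N + 1)) : ℝ≥0) *
            ∫⁻ y in densitySet ((1 / 2) ^ n * ε) E, W y := by
          refine ENNReal.tsum_le_tsum fun i => ?_
          refine (ENNReal.tsum_le_tsum fun x : S i => hball x).trans ?_
          rw [ENNReal.tsum_mul_left]
          gcongr
          exact hfam i
      _ = _ := by
          rw [tsum_fintype]
          simp only [Finset.sum_const, Finset.card_univ, Fintype.card_fin, nsmul_eq_mul]
          ring
  calc 2 * ∫⁻ x in E, W x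
      ≤ 2 * ((1 / (2 * (N + 1)) : ℝ≥0) * (N *
          ∫⁻ y in densitySet ((1 / 2) ^ n * ε) E, W y)) := by gcongr
    _ = ((2 * (1 / (2 * (N + 1)) : ℝ≥0) * N : ℝ≥0) : ℝ≥0∞) *
          ∫⁻ y in densitySet ((1 / 2) ^ n * ε) E, W y := by
        push_cast; ring
    _ ≤ 1 * ∫⁻ y in densitySet ((1 / 2) ^ n * ε) E, W y := by
        gcongr
        rw [ENNReal.coe_le_one_iff]
        have : (2 * (1 / (2 * (N + 1)) : ℝ≥0) * N : ℝ≥0) = N / (N + 1) := by field_simp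
        rw [this]
        exact div_le_one_of_le₀ (by simp) (by positivity)
    _ = _ := one_mul _

theorem setLIntegral_le_of_forall_finite {W : (Fin n → ℝ) → ℝ≥0∞} {a b : ℝ≥0∞}
    {E : Set (Fin n → ℝ)}
    (h : ∀ k : ℕ, a * ∫⁻ x in E ∩ ball 0 k, W x ≤ b) :
    a * ∫⁻ x in E, W x ≤ b := by
  have h1 : ∫⁻ x in E, W x = ⨆ k : ℕ, ∫⁻ x in E ∩ ball 0 k, W x := by
    simp only [← withDensity_apply']
    have hmono : Monotone fun k : ℕ => E ∩ ball (0 : Fin n → ℝ) k := fun i j hij =>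
      inter_subset_inter_right _ (ball_subset_ball (by exact_mod_cast hij))
    rw [← hmono.measure_iUnion, ← inter_iUnion, iUnion_ball_nat, inter_univ]
  rw [h1, ENNReal.mul_iSup]
  exact iSup_le h

/-- Each further doubling composes density sets and multiplies the threshold by q = s₁/15^n, the
composition loss included. -/
theorem exists_pow_mul_setLIntegral_le_densitySet (hn : 0 < n) (C : ℝ≥0) :
    ∃ q : ℝ, 0 < q ∧ q < 1 ∧ ∀ W : (Fin n → ℝ) → ℝ≥0∞, Measurable W → FujiiWilson C W →
      ∀ E, MeasurableSet E → ∀ (k : ℕ) (s : ℝ), s < 1 → s ≤ q ^ k →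
        2 ^ k * ∫⁻ x in E, W x ≤ ∫⁻ x in densitySet s E, W x := by
  obtain ⟨s₁, hs₁, hs₁1, H⟩ := exists_setLIntegral_le_half_densitySet hn C
  have hc1 : (1 / 15 : ℝ) ^ n ≤ 1 := pow_le_one₀ (by norm_num) (by norm_num)
  have hc0 : (0 : ℝ) < (1 / 15 : ℝ) ^ n := by positivity
  have hq : (1 / 15 : ℝ) ^ n * s₁ ≤ s₁ := mul_le_of_le_one_left hs₁.le hc1
  refine ⟨(1 / 15) ^ n * s₁, by positivity, hq.trans_lt hs₁1, fun W hW hFW => ?_⟩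
  have H' : ∀ E, MeasurableSet E →
      2 * ∫⁻ x in E, W x ≤ ∫⁻ x in densitySet s₁ E, W x := by
    intro E hE
    refine setLIntegral_le_of_forall_finite fun k => ?_
    refine (H W hW hFW _ (hE.inter measurableSet_ball) ?_).trans
      (lintegral_mono_set (densitySet_mono le_rfl inter_subset_left))
    exact ((measure_mono inter_subset_right).trans_lt measure_ball_lt_top).ne
  have hpow : ∀ (k : ℕ) E, MeasurableSet E → 2 ^ (k + 1) * ∫⁻ x in E, W x ≤
      ∫⁻ x in densitySet (((1 / 15) ^ n * s₁) ^ (k + 1)) E, W x := by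
    intro k E hE
    induction k with
    | zero =>
      rw [zero_add, pow_one, pow_one]
      exact (H' E hE).trans (lintegral_mono_set (densitySet_mono hq Subset.rfl))
    | succ k ih =>
      rw [pow_succ' (2 : ℝ≥0∞), mul_assoc]
      refine (mul_le_mul_right ih 2).trans ((H' _ (isOpen_densitySet _ _).measurableSet).trans
        (lintegral_mono_set ((densitySet_comp hs₁ hs₁1.le (by positivity) E).trans ?_)))
      refine densitySet_mono (le_of_eq ?_) Subset.rfl
      ring
  intro E hE k s hs1 hsk
  rcases k with _ | k
  -- For k = 0 the threshold may be any s < 1, so the Lebesgue density theorem replaces the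
  -- iteration.
  · rw [pow_zero, one_mul]
    refine lintegral_mono_set' ?_
    have := ae_mem_densitySet hs1 E
    rw [ae_restrict_iff' hE] at this
    exact this
  · exact (hpow k E hE).trans (lintegral_mono_set (densitySet_mono hsk Subset.rfl))

/-- Integrated form of the density estimate, by the layer cake formula. -/
theorem pow_mul_lintegral_le_localMaximal {W : (Fin n → ℝ) → ℝ≥0∞} (hW : Measurable W)
    {f : (Fin n → ℝ) → ℝ≥0∞} (hf : Measurable f) {s : ℝ} {a : ℝ≥0∞}
    (h : ∀ E, MeasurableSet E → a * ∫⁻ x in E, W x ≤ ∫⁻ x in densitySet s E, W x)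
    (hf' : ∀ᵐ x, f x < ∞) (hm : ∀ᵐ x, localMaximal s f x < ∞) :
    a * ∫⁻ x, f x * W x ≤ ∫⁻ x, localMaximal s f x * W x := by
  have hac := withDensity_absolutelyContinuous (volume : Measure (Fin n → ℝ)) W
  -- The layer cake formula is applied to the real-valued `toReal`; finiteness almost everywhere
  -- makes this harmless.
  have key : ∀ g : (Fin n → ℝ) → ℝ≥0∞, Measurable g → (∀ᵐ x, g x < ∞) →
      ∫⁻ x, g x * W x = ∫⁻ t in Ioi (0 : ℝ), ∫⁻ x in {x | ENNReal.ofReal t < g x}, W x := by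
    intro g hg hfin
    have h1 : ∫⁻ x, g x * W x = ∫⁻ x, ENNReal.ofReal (g x).toReal ∂(volume.withDensity W) := by
      rw [lintegral_withDensity_eq_lintegral_mul _ hW hg.ennreal_toReal.ennreal_ofReal]
      refine lintegral_congr_ae ?_
      filter_upwards [hfin] with x hx
      simp [ENNReal.ofReal_toReal hx.ne, mul_comm]
    rw [h1, lintegral_eq_lintegral_meas_lt _ (Eventually.of_forall fun x => ENNReal.toReal_nonneg)
      hg.ennreal_toReal.aemeasurable]
    refine setLIntegral_congr_fun measurableSet_Ioi fun t ht => ?_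
    rw [← withDensity_apply']
    refine measure_congr ?_
    filter_upwards [hac hfin] with x hx
    exact propext (ENNReal.ofReal_lt_iff_lt_toReal (le_of_lt ht) hx.ne).symm
  rw [key f hf hf', key _ (measurable_localMaximal s f) hm]
  have hmeas : Measurable fun t : ℝ => ∫⁻ x in {x | ENNReal.ofReal t < f x}, W x := by
    refine Antitone.measurable fun t t' htt' => lintegral_mono_set
      fun x (hx : ENNReal.ofReal t' < f x) => show ENNReal.ofReal t < f x from ?_
    exact (ENNReal.ofReal_le_ofReal htt').trans_lt hx
  rw [← lintegral_const_mul _ hmeas]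
  refine lintegral_mono fun t => ?_
  refine (h _ (measurableSet_lt measurable_const hf)).trans (le_of_eq ?_)
  simp only [lt_localMaximal_iff]
  rfl

end DensityIteration

/-! ### Calculus of the extended norm and the associate space -/

section Norm

variable {𝕜 : Type*} [RCLike 𝕜] {n : ℕ}

theorem enorm_ofReal_toReal {a : ℝ≥0∞} (ha : a < ∞) : ‖((a.toReal : ℝ) : 𝕜)‖ₑ = a := by
  rw [← ofReal_norm, RCLike.norm_ofReal, abs_of_nonneg ENNReal.toReal_nonneg,
    ENNReal.ofReal_toReal ha.ne]

theorem measurable_enorm_coe (f : L0 𝕜 n) : Measurable fun x => ‖f x‖ₑ :=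
  f.measurable.enorm

/-- One representative serves all spaces at once, so X and X' can be evaluated on the same class. -/
theorem exists_rep_of_ae_finite {g : (Fin n → ℝ) → ℝ≥0∞} (hg : AEMeasurable g)
    (hfin : ∀ᵐ x, g x < ∞) :
    ∃ f : L0 𝕜 n, (∀ᵐ x, f x = (((g x).toReal : ℝ) : 𝕜)) ∧ (∀ᵐ x, ‖f x‖ₑ = g x) ∧
      ∀ X : FunctionSpace 𝕜 n, X.normOf g = X f := by
  have h : AEMeasurable g ∧ ∀ᵐ x, g x < ∞ := ⟨hg, hfin⟩
  refine ⟨AEEqFun.mk (fun x => (((g x).toReal : ℝ) : 𝕜))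
    (RCLike.measurable_ofReal.comp_aemeasurable h.1.ennreal_toReal).aestronglyMeasurable,
    AEEqFun.coeFn_mk _ _, ?_, fun X => ?_⟩
  · filter_upwards [AEEqFun.coeFn_mk (fun x => (((g x).toReal : ℝ) : 𝕜))
      (RCLike.measurable_ofReal.comp_aemeasurable h.1.ennreal_toReal).aestronglyMeasurable,
      hfin] with x hx hx'
    rw [hx, enorm_ofReal_toReal hx']
  · simp only [FunctionSpace.normOf, dif_pos h]

theorem exists_rep {X : FunctionSpace 𝕜 n} {g : (Fin n → ℝ) → ℝ≥0∞} (h : X.normOf g < ∞) :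
    ∃ f : L0 𝕜 n, (∀ᵐ x, f x = (((g x).toReal : ℝ) : 𝕜)) ∧ (∀ᵐ x, ‖f x‖ₑ = g x) ∧
      ∀ Y : FunctionSpace 𝕜 n, Y.normOf g = Y f := by
  by_cases h' : AEMeasurable g ∧ ∀ᵐ x, g x < ∞
  · exact exists_rep_of_ae_finite h'.1 h'.2
  · rw [FunctionSpace.normOf, dif_neg h'] at h
    exact absurd h (lt_irrefl _)

theorem aemeasurable_of_normOf_lt_top {X : FunctionSpace 𝕜 n} {g : (Fin n → ℝ) → ℝ≥0∞}
    (h : X.normOf g < ∞) : AEMeasurable g := by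
  obtain ⟨f, -, hf, -⟩ := exists_rep h
  exact (measurable_enorm_coe f).aemeasurable.congr hf

theorem ae_lt_top_of_normOf_lt_top {X : FunctionSpace 𝕜 n} {g : (Fin n → ℝ) → ℝ≥0∞}
    (h : X.normOf g < ∞) : ∀ᵐ x, g x < ∞ := by
  obtain ⟨f, -, hf, -⟩ := exists_rep h
  filter_upwards [hf] with x hx
  rw [← hx]
  exact enorm_lt_top

namespace IsBanachFunctionSpace

variable {X : FunctionSpace 𝕜 n}

theorem le_of_enorm_le (hX : IsBanachFunctionSpace X) {f g : L0 𝕜 n}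
    (h : ∀ᵐ x, ‖g x‖ₑ ≤ ‖f x‖ₑ) : X g ≤ X f :=
  hX.ideal f g (h.mono fun x hx => by simpa [enorm_le_iff_norm_le] using hx)

theorem normOf_enorm (hX : IsBanachFunctionSpace X) (f : L0 𝕜 n) :
    X.normOf (fun x => ‖f x‖ₑ) = X f := by
  obtain ⟨g, -, hg, hgX⟩ := exists_rep_of_ae_finite (𝕜 := 𝕜) (g := fun x => ‖f x‖ₑ)
    (measurable_enorm_coe f).aemeasurable (Eventually.of_forall fun x => enorm_lt_top)
  rw [hgX]
  exact le_antisymm (hX.le_of_enorm_le (hg.mono fun x hx => hx.le))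
    (hX.le_of_enorm_le (hg.mono fun x hx => hx.ge))

theorem normOf_mono (hX : IsBanachFunctionSpace X) {g h : (Fin n → ℝ) → ℝ≥0∞}
    (hg : AEMeasurable g) (hgh : ∀ᵐ x, g x ≤ h x) : X.normOf g ≤ X.normOf h := by
  by_cases hh : X.normOf h = ∞
  · rw [hh]; exact le_top
  obtain ⟨h', -, hh', hhX⟩ := exists_rep (lt_top_iff_ne_top.2 hh)
  have hfin : ∀ᵐ x, g x < ∞ := by
    filter_upwards [hgh, hh'] with x h1 h2
    exact h1.trans_lt (h2 ▸ enorm_lt_top)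
  obtain ⟨g', -, hg', hgX⟩ := exists_rep_of_ae_finite (𝕜 := 𝕜) hg hfin
  rw [hhX, hgX]
  refine hX.le_of_enorm_le ?_
  filter_upwards [hgh, hh', hg'] with x h1 h2 h3
  rwa [h2, h3]

theorem normOf_zero (hX : IsBanachFunctionSpace X) : X.normOf (fun _ => 0) = 0 := by
  obtain ⟨g, -, hg, hgX⟩ := exists_rep_of_ae_finite (𝕜 := 𝕜) (n := n) (g := fun _ => 0)
    aemeasurable_const (Eventually.of_forall fun x => ENNReal.zero_lt_top)
  rw [hgX, ← nonpos_iff_eq_zero]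
  have h0 : X ((0 : 𝕜) • (0 : L0 𝕜 n)) = 0 := by rw [hX.smul]; simp
  rw [← h0]
  refine hX.le_of_enorm_le ?_
  filter_upwards [hg] with x hx
  rw [hx]
  exact zero_le

theorem ae_eq_zero_of_normOf (hX : IsBanachFunctionSpace X) {g : (Fin n → ℝ) → ℝ≥0∞}
    (h : X.normOf g = 0) : ∀ᵐ x, g x = 0 := by
  obtain ⟨f, -, hf, hfX⟩ := exists_rep (X := X) (g := g) (by rw [h]; exact ENNReal.zero_lt_top)
  rw [hfX] at h
  have h0 := hX.definite f h
  subst h0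
  filter_upwards [hf, AEEqFun.coeFn_zero (α := Fin n → ℝ) (β := 𝕜) (μ := volume)] with x h1 h2
  rw [← h1, h2]
  simp

theorem normOf_add_le (hX : IsBanachFunctionSpace X) (g h : (Fin n → ℝ) → ℝ≥0∞) :
    X.normOf (fun x => g x + h x) ≤ X.normOf g + X.normOf h := by
  by_cases hg : X.normOf g = ∞
  · simp [hg]
  by_cases hh : X.normOf h = ∞
  · simp [hh]
  obtain ⟨g', hg1, hg2, hgX⟩ := exists_rep (lt_top_iff_ne_top.2 hg)
  obtain ⟨h', hh1, hh2, hhX⟩ := exists_rep (lt_top_iff_ne_top.2 hh)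
  have hlt : ∀ᵐ x, g x < ∞ ∧ h x < ∞ := by
    filter_upwards [hg2, hh2] with x h1 h2
    exact ⟨h1 ▸ enorm_lt_top, h2 ▸ enorm_lt_top⟩
  obtain ⟨k, hk1, hk2, hkX⟩ := exists_rep_of_ae_finite (𝕜 := 𝕜) (g := fun x => g x + h x)
    ((aemeasurable_of_normOf_lt_top (lt_top_iff_ne_top.2 hg)).add
      (aemeasurable_of_normOf_lt_top (lt_top_iff_ne_top.2 hh)))
    (hlt.mono fun x hx => ENNReal.add_lt_top.2 hx)
  rw [hkX, hgX, hhX]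
  have : k = g' + h' := by
    refine AEEqFun.ext ?_
    filter_upwards [hk1, hg1, hh1, hlt, AEEqFun.coeFn_add g' h'] with x h1 h2 h3 h4 h5
    rw [h5, h1, Pi.add_apply, h2, h3, ENNReal.toReal_add h4.1.ne h4.2.ne, RCLike.ofReal_add]
  rw [this]
  exact hX.add_le g' h'

theorem normOf_const_mul_le (hX : IsBanachFunctionSpace X) {a : ℝ≥0∞} (ha0 : a ≠ 0) (ha : a ≠ ∞)
    (g : (Fin n → ℝ) → ℝ≥0∞) : X.normOf (fun x => a * g x) ≤ a * X.normOf g := by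
  by_cases hg : X.normOf g = ∞
  · simp [hg, ENNReal.mul_top ha0]
  obtain ⟨g', hg1, hg2, hgX⟩ := exists_rep (lt_top_iff_ne_top.2 hg)
  obtain ⟨k, hk1, hk2, hkX⟩ := exists_rep_of_ae_finite (𝕜 := 𝕜) (g := fun x => a * g x)
    ((aemeasurable_of_normOf_lt_top (lt_top_iff_ne_top.2 hg)).const_mul a)
    (hg2.mono fun x hx => ENNReal.mul_lt_top (lt_top_iff_ne_top.2 ha) (hx ▸ enorm_lt_top))
  rw [hkX, hgX]
  have h1 := hX.smul ((a.toReal : ℝ) : 𝕜) g'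
  rw [enorm_ofReal_toReal (lt_top_iff_ne_top.2 ha)] at h1
  rw [← h1]
  refine hX.le_of_enorm_le ?_
  filter_upwards [hk2, hg2, AEEqFun.coeFn_smul ((a.toReal : ℝ) : 𝕜) g'] with x h1 h2 h3
  rw [h1, h3, Pi.smul_apply, enorm_smul, enorm_ofReal_toReal (lt_top_iff_ne_top.2 ha), h2]

theorem normOf_const_mul (hX : IsBanachFunctionSpace X) {a : ℝ≥0∞} (ha0 : a ≠ 0) (ha : a ≠ ∞)
    (g : (Fin n → ℝ) → ℝ≥0∞) : X.normOf (fun x => a * g x) = a * X.normOf g := by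
  refine le_antisymm (hX.normOf_const_mul_le ha0 ha g) ?_
  have h := hX.normOf_const_mul_le (ENNReal.inv_ne_zero.2 ha) (ENNReal.inv_ne_top.2 ha0)
    (fun x => a * g x)
  simp only [← mul_assoc, ENNReal.inv_mul_cancel ha0 ha, one_mul] at h
  calc a * X.normOf g ≤ a * (a⁻¹ * X.normOf fun x => a * g x) := by gcongr
    _ = _ := by rw [← mul_assoc, ENNReal.mul_inv_cancel ha0 ha, one_mul]

theorem normOf_sum_le (hX : IsBanachFunctionSpace X) {ι : Type*} (s : Finset ι)
    (g : ι → (Fin n → ℝ) → ℝ≥0∞) :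
    X.normOf (fun x => ∑ i ∈ s, g i x) ≤ ∑ i ∈ s, X.normOf (g i) := by
  classical
  induction s using Finset.induction_on with
  | empty => simp [hX.normOf_zero]
  | insert i s hi ih =>
    simp only [Finset.sum_insert hi]
    exact (hX.normOf_add_le _ _).trans (by gcongr)

theorem normOf_iSup_le_of_ae_finite (hX : IsBanachFunctionSpace X)
    {g : ℕ → (Fin n → ℝ) → ℝ≥0∞} (hg : ∀ j, Measurable (g j)) (hmono : Monotone g)
    (hfin : ∀ᵐ x, ⨆ j, g j x < ∞) :
    X.normOf (fun x => ⨆ j, g j x) ≤ ⨆ j, X.normOf (g j) := by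
  by_cases hS : ⨆ j, X.normOf (g j) = ∞
  · rw [hS]; exact le_top
  have hfinj : ∀ j, ∀ᵐ x, g j x < ∞ := fun j => hfin.mono fun x hx =>
    (le_iSup (fun j => g j x) j).trans_lt hx
  choose f hf1 hf2 hfX using fun j => exists_rep_of_ae_finite (𝕜 := 𝕜) (hg j).aemeasurable (hfinj j)
  obtain ⟨k, hk1, hk2, hkX⟩ := exists_rep_of_ae_finite (𝕜 := 𝕜)
    (Measurable.iSup hg).aemeasurable hfin
  rw [hkX]
  simp only [hfX] at hS ⊢
  refine (hX.fatou f k (fun j => ?_) ?_ (lt_top_iff_ne_top.2 hS)).le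
  · filter_upwards [hf1 j, hf1 (j + 1), hfinj (j + 1)] with x h1 h2 h3
    rw [h1, h2]
    exact ⟨RCLike.ofReal_nonneg.2 ENNReal.toReal_nonneg,
      RCLike.ofReal_le_ofReal.2 (ENNReal.toReal_mono h3.ne (hmono (Nat.le_succ j) x))⟩
  · filter_upwards [hk1, ae_all_iff.2 hf1, hfin] with x h1 h2 h3
    simp only [h1, h2]
    refine (RCLike.continuous_ofReal.tendsto _).comp ?_
    exact (ENNReal.tendsto_toReal h3.ne).comp
      (tendsto_atTop_iSup fun i j hij => hmono hij x)

/-- The Fatou property for functions that are not assumed to be finite. -/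
theorem normOf_iSup_le (hX : IsBanachFunctionSpace X)
    {g : ℕ → (Fin n → ℝ) → ℝ≥0∞} (hg : ∀ j, Measurable (g j)) (hmono : Monotone g) :
    X.normOf (fun x => ⨆ j, g j x) ≤ ⨆ j, X.normOf (g j) := by
  by_cases hS : ⨆ j, X.normOf (g j) = ∞
  · rw [hS]; exact le_top
  refine hX.normOf_iSup_le_of_ae_finite hg hmono ?_
  set A := {x | ⨆ j, g j x = ∞} with hA
  have hAm : MeasurableSet A := (Measurable.iSup hg) (measurableSet_singleton ∞)
  by_contra hcon
  have hApos : 0 < volume A := by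
    refine pos_iff_ne_zero.2 fun h0 => hcon ?_
    rw [ae_iff]
    simpa [hA] using h0
  obtain ⟨F, hFA, hFm, hFpos, hFX⟩ := hX.saturation A hAm hApos
  have hne : X.normOf (F.indicator 1) ≠ 0 := by
    intro h0
    refine hFpos.ne' (measure_mono_null (fun x hx => ?_) (ae_iff.1 (hX.ae_eq_zero_of_normOf h0)))
    simp [hx]
  -- The truncations min(g_j, cχ_F) increase to cχ_F because the supremum is infinite on F. Finite
  -- Fatou gives c‖χ_F‖ ≤ sup‖g_j‖ for arbitrarily large c, which is absurd.
  have hk : ∀ k : ℕ, ((k + 1 : ℕ) : ℝ≥0∞) * X.normOf (F.indicator 1) ≤ ⨆ j, X.normOf (g j) := by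
    intro k
    rw [← hX.normOf_const_mul (by positivity) (ENNReal.natCast_ne_top _)]
    set c : ℝ≥0∞ := ((k + 1 : ℕ) : ℝ≥0∞)
    have hc : c ≠ ∞ := ENNReal.natCast_ne_top _
    have hind : Measurable fun x => c * F.indicator (1 : (Fin n → ℝ) → ℝ≥0∞) x :=
      (measurable_one.indicator hFm).const_mul c
    have hlt : ∀ x, c * F.indicator (1 : (Fin n → ℝ) → ℝ≥0∞) x < ∞ := fun x => by
      by_cases hx : x ∈ F <;> simp [hx, lt_top_iff_ne_top.2 hc]
    have hsup : ∀ x, c * F.indicator (1 : (Fin n → ℝ) → ℝ≥0∞) x =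
        ⨆ j, min (g j x) (c * F.indicator 1 x) := by
      intro x
      by_cases hx : x ∈ F
      · have h1 : ⨆ j, g j x = ∞ := hFA hx
        simp only [indicator_of_mem hx, Pi.one_apply, mul_one]
        rw [← iSup_inf_eq, h1, top_inf_eq]
      · simp [hx]
    have h1 := hX.normOf_iSup_le_of_ae_finite
      (g := fun j x => min (g j x) (c * F.indicator 1 x))
      (fun j => (hg j).min hind) (fun i j hij x => min_le_min_right _ (hmono hij x))
      (Eventually.of_forall fun x => by rw [← hsup x]; exact hlt x)
    simp only [← hsup] at h1
    refine h1.trans (iSup_mono fun j => hX.normOf_mono ((hg j).min hind).aemeasurable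
      (Eventually.of_forall fun x => min_le_left _ _))
  obtain ⟨k, hk'⟩ := ENNReal.exists_nat_mul_gt hne hS
  refine (hk'.trans_le (le_trans ?_ (hk k))).false
  gcongr
  simp

theorem normOf_tsum_le (hX : IsBanachFunctionSpace X)
    {g : ℕ → (Fin n → ℝ) → ℝ≥0∞} (hg : ∀ j, Measurable (g j)) :
    X.normOf (fun x => ∑' j, g j x) ≤ ∑' j, X.normOf (g j) := by
  simp only [ENNReal.tsum_eq_iSup_nat]
  refine (hX.normOf_iSup_le (g := fun N x => ∑ j ∈ Finset.range N, g j x)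
    (fun N => Finset.measurable_fun_sum _ fun j _ => hg j) ?_).trans
    (iSup_mono fun N => hX.normOf_sum_le _ _)
  exact fun i j hij x => Finset.sum_le_sum_of_subset (Finset.range_mono hij)

/-- Hölder's inequality for `X` and its associate space. -/
theorem lintegral_mul_le_associate (hX : IsBanachFunctionSpace X) (f : L0 𝕜 n)
    {h : (Fin n → ℝ) → ℝ≥0∞} (hh : X.normOf h < ∞) :
    ∫⁻ x, ‖f x‖ₑ * h x ≤ X.associate f * X.normOf h := by
  obtain ⟨k, -, hk, hkX⟩ := exists_rep hh
  by_cases h0 : X.normOf h = 0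
  · have : ∫⁻ x, ‖f x‖ₑ * h x = 0 := by
      rw [← lintegral_zero (μ := (volume : Measure (Fin n → ℝ)))]
      refine lintegral_congr_ae ?_
      filter_upwards [hX.ae_eq_zero_of_normOf h0] with x hx
      simp [hx]
    rw [this]
    exact zero_le
  set c : ℝ≥0∞ := (X.normOf h)⁻¹ with hc
  have hc0 : c ≠ 0 := ENNReal.inv_ne_zero.2 hh.ne
  have hct : c ≠ ∞ := ENNReal.inv_ne_top.2 h0
  have h1 : X (((c.toReal : ℝ) : 𝕜) • k) ≤ 1 := by
    rw [hX.smul, enorm_ofReal_toReal (lt_top_iff_ne_top.2 hct), ← hkX X,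
      ENNReal.inv_mul_cancel h0 hh.ne]
  have h2 : ∫⁻ x, ‖f x * (((c.toReal : ℝ) : 𝕜) • k) x‖ₑ ≤ X.associate f :=
    le_iSup₂_of_le (f := fun (g : L0 𝕜 n) (_ : X g ≤ 1) => ∫⁻ x, ‖f x * g x‖ₑ) _ h1 le_rfl
  have h3 : ∫⁻ x, ‖f x * (((c.toReal : ℝ) : 𝕜) • k) x‖ₑ = c * ∫⁻ x, ‖f x‖ₑ * h x := by
    rw [← lintegral_const_mul' _ _ hct]
    refine lintegral_congr_ae ?_
    filter_upwards [hk, AEEqFun.coeFn_smul ((c.toReal : ℝ) : 𝕜) k] with x hx1 hx2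
    rw [hx2, Pi.smul_apply, enorm_mul, enorm_smul, hx1,
      enorm_ofReal_toReal (lt_top_iff_ne_top.2 hct)]
    ring
  rw [h3, hc, mul_comm, ← div_eq_mul_inv, ENNReal.div_le_iff h0 hh.ne] at h2
  exact h2

/-- Beyond the defining supremum, g must be shown finite almost everywhere: otherwise saturation
yields a χ_F in X supported where g is infinite, and its pairing with g is infinite. -/
theorem associate_normOf_le (hX : IsBanachFunctionSpace X) {g : (Fin n → ℝ) → ℝ≥0∞}
    (hg : Measurable g) {B : ℝ≥0∞} (hB : B ≠ ∞)
    (h : ∀ k : (Fin n → ℝ) → ℝ≥0∞, Measurable k → X.normOf k < ∞ →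
      ∫⁻ x, g x * k x ≤ B * X.normOf k) :
    X.associate.normOf g ≤ B := by
  have hfin : ∀ᵐ x, g x < ∞ := by
    set A := {x | g x = ∞} with hA
    have hAm : MeasurableSet A := hg (measurableSet_singleton ∞)
    by_contra hcon
    have hApos : 0 < volume A := by
      refine pos_iff_ne_zero.2 fun h0 => hcon ?_
      rw [ae_iff]
      simpa [hA] using h0
    obtain ⟨F, hFA, hFm, hFpos, hFX⟩ := hX.saturation A hAm hApos
    have h1 := h _ (measurable_one.indicator hFm) hFX
    have h2 : ∫⁻ x, g x * F.indicator 1 x = ∞ := by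
      have : ∀ x, g x * F.indicator (1 : (Fin n → ℝ) → ℝ≥0∞) x = F.indicator (fun _ => ∞) x := by
        intro x
        by_cases hx : x ∈ F
        · have : g x = ∞ := hFA hx
          simp [hx, this]
        · simp [hx]
      simp only [this]
      rw [lintegral_indicator_const hFm, ENNReal.top_mul hFpos.ne']
    rw [h2, top_le_iff] at h1
    exact ENNReal.mul_ne_top hB hFX.ne h1
  obtain ⟨f, -, hf, hfX⟩ := exists_rep_of_ae_finite (𝕜 := 𝕜) hg.aemeasurable hfin
  rw [hfX]
  refine iSup₂_le fun k hk => ?_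
  have h1 := h _ (measurable_enorm_coe k) (by
    rw [hX.normOf_enorm]; exact hk.trans_lt ENNReal.one_lt_top)
  rw [hX.normOf_enorm] at h1
  calc ∫⁻ x, ‖f x * k x‖ₑ = ∫⁻ x, g x * ‖k x‖ₑ := by
        refine lintegral_congr_ae ?_
        filter_upwards [hf] with x hx
        rw [enorm_mul, hx]
    _ ≤ B * X k := h1
    _ ≤ B := mul_le_of_le_one_right zero_le hk

end IsBanachFunctionSpace

end Norm

/-! ### From geometric to power lower bounds -/

section PowerBound

/-- Take k = ⌊log s / log q⌋; then 2^k is within a factor 2 of s^(log 2 / log q), which explains δ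
and the 2 in 1/(2C). -/
theorem hasPowerLowerBound_of_pow_le {φ : ℝ → ℝ≥0∞} {q : ℝ} (hq0 : 0 < q) (hq1 : q < 1)
    {C : ℝ≥0} (hC : 0 < C)
    (h : ∀ (k : ℕ) (s : ℝ), 0 < s → s < 1 → s ≤ q ^ k → 2 ^ k ≤ C * φ s) :
    HasPowerLowerBound φ := by
  have hlq : Real.log q < 0 := Real.log_neg hq0 hq1
  have hC' : (0 : ℝ) < C := hC
  refine ⟨1 / (2 * C), by positivity, -(Real.log 2 / Real.log q), ?_, fun s hs => ?_⟩
  · have := div_neg_of_pos_of_neg (Real.log_pos one_lt_two) hlq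
    linarith
  have hls : Real.log s < 0 := Real.log_neg hs.1 hs.2
  set x := Real.log s / Real.log q with hx
  have hx0 : 0 ≤ x := (div_pos_of_neg_of_neg hls hlq).le
  set k := ⌊x⌋₊ with hk
  have hkx : (k : ℝ) ≤ x := Nat.floor_le hx0
  have hxk : x < k + 1 := Nat.lt_floor_add_one x
  have hsq : s ≤ q ^ k := by
    rw [← Real.log_le_log_iff hs.1 (by positivity), Real.log_pow]
    have : x * Real.log q = Real.log s := by
      rw [hx, div_mul_cancel₀ _ hlq.ne]
    nlinarith
  have h1 := h k s hs.1 hs.2 hsq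
  have h2 : s ^ (- -(Real.log 2 / Real.log q)) ≤ 2 * 2 ^ k := by
    have h3 : s ^ (- -(Real.log 2 / Real.log q)) = (2 : ℝ) ^ x := by
      rw [Real.rpow_def_of_pos hs.1, Real.rpow_def_of_pos two_pos, hx]
      congr 1
      ring
    rw [h3, ← pow_succ', ← Real.rpow_natCast]
    refine Real.rpow_le_rpow_of_exponent_le one_le_two ?_
    push_cast
    exact hxk.le
  have h4 : ENNReal.ofReal (1 / (2 * C) * s ^ (- -(Real.log 2 / Real.log q))) ≤ 2 ^ k / C := by
    have h5 : 1 / (2 * C) * s ^ (- -(Real.log 2 / Real.log q)) ≤ 2 ^ k / C := by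
      calc 1 / (2 * C) * s ^ (- -(Real.log 2 / Real.log q)) ≤ 1 / (2 * C) * (2 * 2 ^ k) := by
            gcongr
        _ = 2 ^ k / C := by field_simp
    refine (ENNReal.ofReal_le_ofReal h5).trans (le_of_eq ?_)
    rw [ENNReal.ofReal_div_of_pos hC', ENNReal.ofReal_pow two_pos.le]
    simp
  refine h4.trans ?_
  rw [ENNReal.div_le_iff' (by exact_mod_cast hC.ne') ENNReal.coe_ne_top]
  exact h1

theorem HasPowerLowerBound.unboundedOnUnit {φ : ℝ → ℝ≥0∞} (h : HasPowerLowerBound φ) :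
    UnboundedOnUnit φ := by
  obtain ⟨C, hC, δ, hδ, H⟩ := h
  intro K
  obtain ⟨y, hy, hy1⟩ := (((tendsto_rpow_atTop hδ).const_mul_atTop hC).eventually_gt_atTop
    (K : ℝ)).and (eventually_gt_atTop 1) |>.exists
  have hy0 : 0 < y := one_pos.trans hy1
  refine ⟨y⁻¹, ⟨inv_pos.2 hy0, inv_lt_one_of_one_lt₀ hy1⟩, ?_⟩
  refine lt_of_lt_of_le ?_ (H y⁻¹ ⟨inv_pos.2 hy0, inv_lt_one_of_one_lt₀ hy1⟩)
  rw [Real.inv_rpow hy0.le, Real.rpow_neg hy0.le, inv_inv, ← ENNReal.ofReal_coe_nnreal]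
  exact (ENNReal.ofReal_lt_ofReal_iff_of_nonneg K.2).2 hy

end PowerBound

/-! ### A_∞-regularity: the power bound and Rubio de Francia -/

section Regularity

variable {𝕜 : Type*} [RCLike 𝕜] {n : ℕ}

theorem IsWeight.exists_fujiiWilson {w : (Fin n → ℝ) → ℝ} (hw : IsWeight w) {C : ℝ≥0}
    (hC : aInftyConst w ≤ C) :
    ∃ W : (Fin n → ℝ) → ℝ≥0∞, Measurable W ∧ (∀ᵐ x, W x = ENNReal.ofReal (w x)) ∧
      FujiiWilson C W := by
  have hm : AEMeasurable fun x => ENNReal.ofReal (w x) :=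
    hw.2.aestronglyMeasurable.aemeasurable.ennreal_ofReal
  have hae : hm.mk =ᵐ[volume] fun x => ENNReal.ofReal (w x) := hm.ae_eq_mk.symm
  refine ⟨hm.mk, hm.measurable_mk, hae, fun c r hr => ?_⟩
  have hint : ∫⁻ x in ball c r, hm.mk _ x = ∫⁻ x in ball c r, ENNReal.ofReal (w x) :=
    lintegral_congr_ae (ae_restrict_of_ae hae)
  have hmax : maximal ((ball c r).indicator (hm.mk _)) =
      maximal ((ball c r).indicator fun x => ENNReal.ofReal (w x)) := by
    refine maximal_congr_ae ?_
    filter_upwards [hae] with x hx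
    by_cases h : x ∈ ball c r <;> simp [h, hx]
  have hfin : ∫⁻ x in ball c r, ENNReal.ofReal (w x) ≠ ∞ := by
    have h1 : IntegrableOn w (ball c r) :=
      (hw.2.integrableOn_isCompact (isCompact_closedBall c r)).mono_set ball_subset_closedBall
    exact h1.lintegral_lt_top.ne
  rw [hint, hmax]
  refine ⟨hfin, ?_⟩
  -- The quotient can be cleared only when w(Q) ≠ 0; if w(Q) = 0 the localized maximal function
  -- vanishes.
  by_cases h0 : ∫⁻ x in ball c r, ENNReal.ofReal (w x) = 0
  · have hz : maximal ((ball c r).indicator fun x => ENNReal.ofReal (w x)) =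
        maximal (fun _ : Fin n → ℝ => 0) := by
      refine maximal_congr_ae ?_
      rw [← lintegral_indicator measurableSet_ball,
        lintegral_eq_zero_iff' (hm.indicator measurableSet_ball)] at h0
      exact h0
    have hz' : ∀ x : Fin n → ℝ, maximal (fun _ : Fin n → ℝ => (0 : ℝ≥0∞)) x = 0 := fun x =>
      le_antisymm (maximal_le fun _ _ _ _ => by simp) zero_le
    rw [hz]
    simp [hz']
  · have h1 : (∫⁻ x in ball c r, maximal ((ball c r).indicator fun y => ENNReal.ofReal (w y)) x) /
        ∫⁻ x in ball c r, ENNReal.ofReal (w x) ≤ C :=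
      (le_iSup₂_of_le (f := fun (Q : Set (Fin n → ℝ)) (_ : IsCube Q) =>
        (∫⁻ x in Q, maximal (Q.indicator fun y => ENNReal.ofReal (w y)) x) /
          ∫⁻ x in Q, ENNReal.ofReal (w x)) _ (isCube_ball c hr) le_rfl).trans hC
    rwa [ENNReal.div_le_iff h0 hfin] at h1

/-- Replacing g in the unit ball of X by its A_∞ majorant lets the weighted density estimate act on
∫|fg|; Hölder then brings back ‖m_s f‖_{X'} at the cost of C₂. -/
theorem IsAInftyRegular.hasPowerLowerBound (hn : 0 < n) {X : FunctionSpace 𝕜 n}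
    (hX : IsBanachFunctionSpace X) (h : IsAInftyRegular X) :
    HasPowerLowerBound (phi X.associate) := by
  obtain ⟨C₁, C₂, -, hC₂, H⟩ := h
  obtain ⟨q, hq0, hq1, hq⟩ := exists_pow_mul_setLIntegral_le_densitySet hn C₁
  refine hasPowerLowerBound_of_pow_le hq0 hq1 hC₂ fun k s hs0 hs1 hsk => ?_
  have hC₂0 : (C₂ : ℝ≥0∞) ≠ 0 := by exact_mod_cast hC₂.ne'
  rw [phi, ENNReal.mul_iInf_of_ne hC₂0 ENNReal.coe_ne_top]
  refine le_iInf fun f => ?_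
  rw [ENNReal.mul_iInf_of_ne hC₂0 ENNReal.coe_ne_top]
  refine le_iInf fun hf => ?_
  set m := localMaximal s fun x => ‖f x‖ₑ with hm
  by_cases hmX : X.associate.normOf m = ∞
  · rw [hmX, ENNReal.mul_top hC₂0]; exact le_top
  obtain ⟨m', -, hm', hmX'⟩ := exists_rep (lt_top_iff_ne_top.2 hmX)
  have hmfin := ae_lt_top_of_normOf_lt_top (lt_top_iff_ne_top.2 hmX)
  have hsup : (2 : ℝ≥0∞) ^ k * X.associate f ≤ C₂ * X.associate.normOf m := by
    rw [FunctionSpace.associate, ENNReal.mul_iSup]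
    refine iSup_le fun g => ?_
    rw [ENNReal.mul_iSup]
    refine iSup_le fun hg => ?_
    obtain ⟨w, hw, hgw, hwC, hwX⟩ := H g (hg.trans_lt ENNReal.one_lt_top)
    obtain ⟨W, hWm, hWw, hFW⟩ := hw.exists_fujiiWilson hwC
    have hWX : X.normOf W ≤ C₂ := by
      refine (hX.normOf_mono hWm.aemeasurable (hWw.mono fun x hx => hx.le)).trans (hwX.trans ?_)
      exact mul_le_of_le_one_right zero_le hg
    calc (2 : ℝ≥0∞) ^ k * ∫⁻ x, ‖f x * g x‖ₑ ≤ 2 ^ k * ∫⁻ x, ‖f x‖ₑ * W x := by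
          gcongr 2 ^ k * ?_
          refine lintegral_mono_ae ?_
          filter_upwards [hgw, hWw] with x h1 h2
          rw [enorm_mul, h2, ← ofReal_norm (g x)]
          gcongr
      _ ≤ ∫⁻ x, m x * W x :=
          pow_mul_lintegral_le_localMaximal hWm (measurable_enorm_coe f)
            (fun E hE => hq W hWm hFW E hE k s hs1 hsk)
            (Eventually.of_forall fun x => enorm_lt_top) hmfin
      _ = ∫⁻ x, ‖m' x‖ₑ * W x := by
          refine lintegral_congr_ae ?_
          filter_upwards [hm'] with x hx
          rw [hx]
      _ ≤ X.associate m' * X.normOf W :=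
          hX.lintegral_mul_le_associate m' (hWX.trans_lt ENNReal.coe_lt_top)
      _ ≤ X.associate m' * C₂ := by gcongr
      _ = C₂ * X.associate.normOf m := by rw [hmX' X.associate, mul_comm]
  rwa [hf, mul_one] at hsup

theorem MaximalBoundedOn.exists_normOf_maximal_le {X : FunctionSpace 𝕜 n}
    (h : MaximalBoundedOn X) :
    ∃ C : ℝ≥0, 1 ≤ C ∧ ∀ g : (Fin n → ℝ) → ℝ≥0∞,
      X.normOf (maximal g) ≤ C * X.normOf g := by
  obtain ⟨C, hC⟩ := h
  refine ⟨C + 1, by simp, fun g => ?_⟩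
  by_cases hg : X.normOf g = ∞
  · rw [hg, ENNReal.mul_top (by simp)]
    exact le_top
  obtain ⟨f, -, hf, hfX⟩ := exists_rep (lt_top_iff_ne_top.2 hg)
  have h1 := hC f (by rw [← hfX X]; exact lt_top_iff_ne_top.2 hg)
  rw [maximal_congr_ae hf, ← hfX X] at h1
  refine h1.trans ?_
  gcongr
  simp

/-- The Rubio de Francia algorithm: boundedness of the maximal operator gives `A_1`, hence `A_∞`,
majorants. -/
theorem MaximalBoundedOn.isAInftyRegular {X : FunctionSpace 𝕜 n}
    (hX : IsBanachFunctionSpace X) (h : MaximalBoundedOn X) : IsAInftyRegular X := by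
  obtain ⟨C, hC1, hC⟩ := h.exists_normOf_maximal_le
  have hC0 : (C : ℝ≥0∞) ≠ 0 := by
    have : C ≠ 0 := (zero_lt_one.trans_le hC1).ne'
    exact_mod_cast this
  set A : ℝ≥0∞ := 2 * C with hA
  have hA0 : A ≠ 0 := mul_ne_zero two_ne_zero hC0
  have hAt : A ≠ ∞ := ENNReal.mul_ne_top (by norm_num) ENNReal.coe_ne_top
  have hAi0 : A⁻¹ ≠ 0 := ENNReal.inv_ne_zero.2 hAt
  have hAit : A⁻¹ ≠ ∞ := ENNReal.inv_ne_top.2 hA0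
  refine ⟨2 * C, 2, by have := zero_lt_one.trans_le hC1; positivity, by norm_num, fun f hf => ?_⟩
  let g : ℕ → (Fin n → ℝ) → ℝ≥0∞ := fun k => maximal^[k] fun x => ‖f x‖ₑ
  have hgs : ∀ k, g (k + 1) = maximal (g k) := fun k => Function.iterate_succ_apply' _ _ _
  have hgm : ∀ k, Measurable (g k) := by
    intro k
    cases k with
    | zero => exact measurable_enorm_coe f
    | succ k => rw [hgs]; exact measurable_maximal _
  have hgX : ∀ k, X.normOf (g k) ≤ C ^ k * X f := by
    intro k
    induction k with
    | zero => simp [g, hX.normOf_enorm]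
    | succ k ih =>
      rw [hgs, pow_succ', mul_assoc]
      exact (hC _).trans (by gcongr)
  -- With A = 2C the norms of the terms decay like 2^(-k), and applying the maximal operator shifts
  -- the series by one index, so MW ≤ A·W.
  let W : (Fin n → ℝ) → ℝ≥0∞ := fun x => ∑' k, A⁻¹ ^ k * g k x
  have hterm : ∀ k, Measurable fun x => A⁻¹ ^ k * g k x := fun k => (hgm k).const_mul _
  have hWm : Measurable W := Measurable.tsum hterm
  have hWX : X.normOf W ≤ 2 * X f := by
    refine (hX.normOf_tsum_le hterm).trans ?_
    have h1 : ∀ k, X.normOf (fun x => A⁻¹ ^ k * g k x) ≤ 2⁻¹ ^ k * X f := by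
      intro k
      rw [hX.normOf_const_mul (pow_ne_zero _ hAi0) (ENNReal.pow_ne_top hAit)]
      refine (mul_le_mul_right (hgX k) _).trans (le_of_eq ?_)
      rw [← mul_assoc, ← mul_pow, hA, ENNReal.mul_inv (by simp) (by simp), mul_assoc,
        ENNReal.inv_mul_cancel hC0 ENNReal.coe_ne_top, mul_one]
    refine (ENNReal.tsum_le_tsum h1).trans (le_of_eq ?_)
    rw [ENNReal.tsum_mul_right, ENNReal.tsum_geometric_two]
  have hWlt : X.normOf W < ∞ := hWX.trans_lt (ENNReal.mul_lt_top (by norm_num) hf)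
  have hWfin : ∀ᵐ x, W x < ∞ := ae_lt_top_of_normOf_lt_top hWlt
  have hMW : ∀ x, maximal W x ≤ A * W x := by
    intro x
    refine (maximal_tsum_le (fun k => (hterm k).aemeasurable) x).trans ?_
    have h1 : ∀ k, maximal (fun x => A⁻¹ ^ k * g k x) x ≤ A * (A⁻¹ ^ (k + 1) * g (k + 1) x) := by
      intro k
      refine (maximal_const_mul _ (ENNReal.pow_ne_top hAit) _ x).trans (le_of_eq ?_)
      rw [hgs, pow_succ', ← mul_assoc, ← mul_assoc, ENNReal.mul_inv_cancel hA0 hAt, one_mul]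
    refine (ENNReal.tsum_le_tsum h1).trans ?_
    rw [ENNReal.tsum_mul_left]
    gcongr
    exact ENNReal.tsum_comp_le_tsum_of_injective (add_left_injective 1)
      fun k => A⁻¹ ^ k * g k x
  have hWw : ∀ᵐ x, ENNReal.ofReal (W x).toReal = W x :=
    hWfin.mono fun x hx => ENNReal.ofReal_toReal hx.ne
  -- One point of the cube with W finite suffices: the average is at most MW ≤ A·W there.
  have hWball : ∀ (c : Fin n → ℝ) (r : ℝ), 0 < r → ∫⁻ x in ball c r, W x ≠ ∞ := by
    intro c r hr
    obtain ⟨x, hx, hxb⟩ : ∃ x, W x < ∞ ∧ x ∈ ball c r := by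
      by_contra! hcon
      refine volume_ball_ne_zero c hr (measure_mono_null (fun x hx => ?_) (ae_iff.1 hWfin))
      exact fun hlt => hcon x hlt hx
    exact ((setLIntegral_le_maximal W hxb).trans_lt (ENNReal.mul_lt_top ((hMW x).trans_lt
      (ENNReal.mul_lt_top (lt_top_iff_ne_top.2 hAt) hx))
      (lt_top_iff_ne_top.2 (volume_ball_ne_top c r)))).ne
  refine ⟨fun x => (W x).toReal, ⟨fun x => ENNReal.toReal_nonneg, fun x => ?_⟩, ?_, ?_, ?_⟩
  · refine ⟨ball x 1, ball_mem_nhds x one_pos, ?_⟩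
    exact integrable_toReal_of_lintegral_ne_top hWm.aemeasurable (hWball x 1 one_pos)
  · filter_upwards [hWfin] with x hx
    have h1 : ‖f x‖ₑ ≤ W x := by
      refine le_trans (le_of_eq ?_) (ENNReal.le_tsum 0)
      simp [g]
    have h2 := ENNReal.toReal_mono hx.ne h1
    simpa using h2
  · refine iSup₂_le fun Q _ => ENNReal.div_le_of_le_mul ?_
    rw [lintegral_congr_ae (ae_restrict_of_ae hWw)]
    calc ∫⁻ x in Q, maximal (Q.indicator fun y => ENNReal.ofReal (W y).toReal) x
        ≤ ∫⁻ x in Q, A * W x := by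
          refine lintegral_mono fun x => (maximal_mono_ae ?_ x).trans (hMW x)
          filter_upwards [hWw] with y hy
          by_cases hQ : y ∈ Q <;> simp [hQ, hy]
      _ = _ := by
          rw [lintegral_const_mul _ hWm, hA]
          push_cast
          rfl
  · exact (hX.normOf_mono (hWm.ennreal_toReal.ennreal_ofReal).aemeasurable
      (hWw.mono fun x hx => hx.le)).trans hWX

end Regularity

/-! ### Averages at fixed scale and linearization of the maximal operator -/

section BallAverage

variable {n : ℕ}

/-- The average of `h` over the cube with centre `y` and side length `2 * r`. -/
def ballAverage (r : ℝ) (h : (Fin n → ℝ) → ℝ≥0∞) (y : Fin n → ℝ) : ℝ≥0∞ :=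
  (∫⁻ x in ball y r, h x) / volume (ball (0 : Fin n → ℝ) r)

theorem setLIntegral_ball_eq_lintegral (r : ℝ) (h : (Fin n → ℝ) → ℝ≥0∞) (y : Fin n → ℝ) :
    ∫⁻ x in ball y r, h x =
      ∫⁻ x, {p : (Fin n → ℝ) × (Fin n → ℝ) | dist p.1 p.2 < r}.indicator (fun p => h p.2) (y, x) := by
  rw [← lintegral_indicator measurableSet_ball]
  refine lintegral_congr fun x => ?_
  simp only [indicator, mem_ball, mem_ofPred_eq, dist_comm]

theorem measurableSet_dist_lt (r : ℝ) :
    MeasurableSet {p : (Fin n → ℝ) × (Fin n → ℝ) | dist p.1 p.2 < r} :=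
  measurableSet_lt measurable_dist measurable_const

theorem measurable_setLIntegral_ball (r : ℝ) {h : (Fin n → ℝ) → ℝ≥0∞} (hh : Measurable h) :
    Measurable fun y => ∫⁻ x in ball y r, h x := by
  simp only [setLIntegral_ball_eq_lintegral]
  exact ((hh.comp measurable_snd).indicator (measurableSet_dist_lt r)).lintegral_prod_right'

theorem measurable_ballAverage (r : ℝ) {h : (Fin n → ℝ) → ℝ≥0∞} (hh : Measurable h) :
    Measurable (ballAverage r h) :=
  (measurable_setLIntegral_ball r hh).div_const _

theorem lintegral_mul_setLIntegral_ball_comm (r : ℝ) {g h : (Fin n → ℝ) → ℝ≥0∞}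
    (hg : Measurable g) (hh : Measurable h) :
    ∫⁻ y, g y * ∫⁻ x in ball y r, h x = ∫⁻ x, h x * ∫⁻ y in ball x r, g y := by
  have key : ∀ {g h : (Fin n → ℝ) → ℝ≥0∞}, Measurable h → ∀ y, g y * ∫⁻ x in ball y r, h x =
      ∫⁻ x, {p : (Fin n → ℝ) × (Fin n → ℝ) | dist p.1 p.2 < r}.indicator
        (fun p => g p.1 * h p.2) (y, x) := by
    intro g h hh y
    rw [setLIntegral_ball_eq_lintegral, ← lintegral_const_mul]
    · refine lintegral_congr fun x => ?_
      simp only [indicator, mul_ite, mul_zero]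
    · exact ((hh.comp measurable_snd).indicator (measurableSet_dist_lt r)).comp
        measurable_prodMk_left
  simp only [key hh, key hg]
  rw [lintegral_lintegral_swap]
  · refine lintegral_congr fun x => lintegral_congr fun y => ?_
    simp only [indicator, mem_ofPred_eq, dist_comm, mul_comm]
  · exact (((hg.comp measurable_fst).mul (hh.comp measurable_snd)).indicator
      (measurableSet_dist_lt r)).aemeasurable

theorem lintegral_mul_ballAverage_comm (r : ℝ) {g h : (Fin n → ℝ) → ℝ≥0∞}
    (hg : Measurable g) (hh : Measurable h) :
    ∫⁻ y, g y * ballAverage r h y = ∫⁻ x, h x * ballAverage r g x := by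
  simp only [ballAverage, div_eq_mul_inv, ← mul_assoc]
  rw [lintegral_mul_const (f := fun y => g y * ∫⁻ x in ball y r, h x) _
      (hg.mul (measurable_setLIntegral_ball r hh)),
    lintegral_mul_const (f := fun y => h y * ∫⁻ x in ball y r, g x) _
      (hh.mul (measurable_setLIntegral_ball r hg)),
    lintegral_mul_setLIntegral_ball_comm r hg hh]

theorem ballAverage_le_maximal {r : ℝ} (hr : 0 < r) (h : (Fin n → ℝ) → ℝ≥0∞) (y : Fin n → ℝ) :
    ballAverage r h y ≤ maximal h y := by
  rw [ballAverage, ← Measure.addHaar_ball_center volume y]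
  exact le_maximal h (mem_ball_self hr)

theorem ballAverage_mono_of_le {r : ℝ} {g h : (Fin n → ℝ) → ℝ≥0∞} (hgh : ∀ x, g x ≤ h x)
    (y : Fin n → ℝ) : ballAverage r g y ≤ ballAverage r h y :=
  ENNReal.div_le_div_right (lintegral_mono hgh) _

theorem ballAverage_le_two_mul {x y : Fin n → ℝ} {r : ℝ} (hr : 0 < r) (hxy : dist x y ≤ r)
    (h : (Fin n → ℝ) → ℝ≥0∞) : ballAverage r h y ≤ 2 ^ n * ballAverage (2 * r) h x := by
  have h2 : ENNReal.ofReal 2 ^ n = 2 ^ n := by norm_num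
  rw [ballAverage, ballAverage, volume_ball_mul 0 0 two_pos hr, h2, ← mul_div_assoc,
    ENNReal.mul_div_mul_left _ _ (by positivity) (ENNReal.pow_ne_top (by norm_num))]
  refine ENNReal.div_le_div_right (lintegral_mono_set (ball_subset_ball' ?_)) _
  rw [dist_comm]
  linarith

/-- By self-adjointness the average falls on the indicator of the cube; it stays at most 1 and lives
within radius r + R ≤ 3r. -/
theorem setLIntegral_ballAverage_le {c : Fin n → ℝ} {r R : ℝ}
    (hRr : R ≤ 2 * r) {h : (Fin n → ℝ) → ℝ≥0∞} (hh : Measurable h) :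
    ∫⁻ y in ball c r, ballAverage R h y ≤ ∫⁻ x in ball c (3 * r), h x := by
  have h1 : ∫⁻ y in ball c r, ballAverage R h y =
      ∫⁻ y, (ball c r).indicator 1 y * ballAverage R h y := by
    rw [← lintegral_indicator measurableSet_ball]
    refine lintegral_congr fun y => ?_
    by_cases hy : y ∈ ball c r <;> simp [hy]
  rw [h1, lintegral_mul_ballAverage_comm R (measurable_one.indicator measurableSet_ball) hh,
    ← lintegral_indicator measurableSet_ball]
  refine lintegral_mono fun x => ?_
  have h2 : ∫⁻ y in ball x R, (ball c r).indicator 1 y = volume (ball c r ∩ ball x R) := by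
    rw [lintegral_indicator_one measurableSet_ball, Measure.restrict_apply measurableSet_ball]
  by_cases hx : x ∈ ball c (3 * r)
  · rw [indicator_of_mem hx, ballAverage, h2]
    refine mul_le_of_le_one_right zero_le (ENNReal.div_le_of_le_mul ?_)
    rw [one_mul, ← Measure.addHaar_ball_center volume x]
    exact measure_mono inter_subset_right
  · have h3 : ball c r ∩ ball x R = ∅ := by
      rw [← disjoint_iff_inter_eq_empty]
      refine ball_disjoint_ball ?_
      rw [mem_ball, not_lt, dist_comm] at hx
      linarith
    rw [indicator_of_notMem hx, ballAverage, h2, h3]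
    simp

/-- For 2^k ≤ 2r < 2^(k+1), the cube of radius 2^(k+1) centred at x contains the given cube, and
2^(k+1) ≤ 4r. -/
theorem maximal_le_iSup_ballAverage (g : (Fin n → ℝ) → ℝ≥0∞) (x : Fin n → ℝ) :
    maximal g x ≤ 4 ^ n * ⨆ k : ℤ, ballAverage ((2 : ℝ) ^ k) g x := by
  refine maximal_le fun c r hr hx => ?_
  obtain ⟨k, hk1, hk2⟩ := exists_mem_Ico_zpow (show 0 < 2 * r by positivity) one_lt_two
  have hpos : (0 : ℝ) < 2 ^ (k + 1) := by positivity
  have h4 : (2 : ℝ) ^ (k + 1) ≤ 4 * r := by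
    rw [zpow_add_one₀ two_ne_zero]; linarith
  refine le_trans ?_ (mul_le_mul_right (le_iSup (fun k : ℤ => ballAverage ((2 : ℝ) ^ k) g x) (k + 1))
    _)
  have hof : ENNReal.ofReal 4 ^ n = 4 ^ n := by norm_num
  have hvol : volume (ball (0 : Fin n → ℝ) (2 ^ (k + 1))) ≤ 4 ^ n * volume (ball c r) := by
    rw [← hof, ← volume_ball_mul 0 c (by norm_num) hr]
    exact measure_mono (ball_subset_ball h4)
  have hsub : ball c r ⊆ ball x (2 ^ (k + 1)) := by
    refine ball_subset_ball' ?_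
    have : dist x c < r := hx
    rw [dist_comm] at this
    linarith
  rw [ballAverage, ENNReal.div_le_iff (volume_ball_ne_zero c hr) (volume_ball_ne_top c r)]
  calc ∫⁻ y in ball c r, g y ≤ ∫⁻ y in ball x (2 ^ (k + 1)), g y := lintegral_mono_set hsub
    _ = (∫⁻ y in ball x (2 ^ (k + 1)), g y) / volume (ball (0 : Fin n → ℝ) (2 ^ (k + 1))) *
          volume (ball (0 : Fin n → ℝ) (2 ^ (k + 1))) :=
        (ENNReal.div_mul_cancel (volume_ball_ne_zero _ hpos) (volume_ball_ne_top _ _)).symm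
    _ ≤ (∫⁻ y in ball x (2 ^ (k + 1)), g y) / volume (ball (0 : Fin n → ℝ) (2 ^ (k + 1))) *
          (4 ^ n * volume (ball c r)) := by gcongr
    _ = _ := by ring

/-- The local maximal function of a finite sum of averages over cubes of comparable scales. -/
theorem localMaximal_sum_ballAverage_le {ι : Type*} (S : Finset ι) {ρ : ι → ℝ}
    (hρ : ∀ k, 0 < ρ k) {f : ι → (Fin n → ℝ) → ℝ≥0∞} (hf : ∀ k, Measurable (f k))
    {F : (Fin n → ℝ) → ℝ≥0∞} (hF : ∀ x, ∑ k ∈ S, f k x ≤ F x) {s : ℝ} (hs : 0 < s)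
    (x : Fin n → ℝ) :
    localMaximal s (fun y => ∑ k ∈ S, ballAverage (ρ k) (f k) y) x ≤
      2 ^ n * ∑ k ∈ S, ballAverage (2 * ρ k) (f k) x +
        3 ^ n / ENNReal.ofReal s * maximal F x := by
  set L := 2 ^ n * ∑ k ∈ S, ballAverage (2 * ρ k) (f k) x with hL
  set a := 3 ^ n / ENNReal.ofReal s * maximal F x with ha
  have hs0 : ENNReal.ofReal s ≠ 0 := by simpa using hs
  rw [localMaximal_le_iff]
  rintro ⟨c, r, hr, hx, hlt⟩
  refine hlt.not_ge ?_
  have h3 : ENNReal.ofReal 3 ^ n = 3 ^ n := by norm_num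
  -- Scales below 2r see only the tripled cube, so the integral of σ is controlled by MF(x) and
  -- Chebyshev applies. Scales at least 2r vary little on the cube and are compared with doubled
  -- averages at x.
  set σ : (Fin n → ℝ) → ℝ≥0∞ := fun y =>
    ∑ k ∈ S with ρ k < 2 * r, ballAverage (ρ k) (f k) y with hσ
  have hσm : Measurable σ := Finset.measurable_fun_sum _ fun k _ => measurable_ballAverage _ (hf k)
  have hσint : ∫⁻ y in ball c r, σ y ≤ a * (ENNReal.ofReal s * volume (ball c r)) := by
    calc ∫⁻ y in ball c r, σ y
        = ∑ k ∈ S with ρ k < 2 * r, ∫⁻ y in ball c r, ballAverage (ρ k) (f k) y :=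
          lintegral_finsetSum _ fun k _ => measurable_ballAverage _ (hf k)
      _ ≤ ∑ k ∈ S with ρ k < 2 * r, ∫⁻ y in ball c (3 * r), f k y :=
          Finset.sum_le_sum fun k hk => setLIntegral_ballAverage_le
            (Finset.mem_filter.1 hk).2.le (hf k)
      _ ≤ ∑ k ∈ S, ∫⁻ y in ball c (3 * r), f k y :=
          Finset.sum_le_sum_of_subset (Finset.filter_subset _ _)
      _ = ∫⁻ y in ball c (3 * r), ∑ k ∈ S, f k y :=
          (lintegral_finsetSum _ fun k _ => hf k).symm
      _ ≤ ∫⁻ y in ball c (3 * r), F y := lintegral_mono hF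
      _ ≤ maximal F x * volume (ball c (3 * r)) :=
          setLIntegral_le_maximal F (ball_subset_ball (by linarith) hx)
      _ = 3 ^ n / ENNReal.ofReal s * ENNReal.ofReal s * maximal F x * volume (ball c r) := by
          rw [ENNReal.div_mul_cancel hs0 ENNReal.ofReal_ne_top,
            volume_ball_mul c c (by norm_num) hr, h3]
          ring
      _ = a * (ENNReal.ofReal s * volume (ball c r)) := by rw [ha]; ring
  have hsplit : ∀ y ∈ ball c r, ∑ k ∈ S, ballAverage (ρ k) (f k) y ≤ L + σ y := by
    intro y hy
    rw [← Finset.sum_filter_not_add_sum_filter S (fun k => ρ k < 2 * r), hL]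
    gcongr
    rw [Finset.mul_sum]
    refine le_trans (Finset.sum_le_sum fun k hk => ?_)
      (Finset.sum_le_sum_of_subset (Finset.filter_subset (fun k => ¬ρ k < 2 * r) _))
    have hk' : 2 * r ≤ ρ k := not_lt.1 (Finset.mem_filter.1 hk).2
    refine ballAverage_le_two_mul (hρ k) ?_ _
    have h1 : dist x c < r := hx
    have h2 : dist y c < r := hy
    linarith [dist_triangle_right x y c]
  set P := ball c r ∩ {y | L + a < ∑ k ∈ S, ballAverage (ρ k) (f k) y} with hP
  have hPσ : P ⊆ ball c r ∩ {y | a < σ y} := by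
    rintro y ⟨hy, hlt⟩
    exact ⟨hy, lt_of_add_lt_add_left ((show L + a < _ from hlt).trans_le (hsplit y hy))⟩
  have hvolP : a * volume P ≤ a * (ENNReal.ofReal s * volume (ball c r)) := by
    refine le_trans ?_ hσint
    calc a * volume P ≤ a * volume.restrict (ball c r) {y | a ≤ σ y} := by
          gcongr a * ?_
          rw [Measure.restrict_apply (measurableSet_le measurable_const hσm), inter_comm]
          exact measure_mono (hPσ.trans (inter_subset_inter_right _ fun y (hy : a < σ y) => hy.le))
      _ ≤ ∫⁻ y in ball c r, σ y := mul_meas_ge_le_lintegral hσm a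
  by_cases hat : a = ∞
  · have : P = ∅ := by
      ext y
      simp [hP, hat]
    rw [this]
    simp
  by_cases ha0 : a = 0
  · have h0 : ∫⁻ y in ball c r, σ y = 0 := by
      rw [ha0, zero_mul] at hσint
      exact le_antisymm hσint zero_le
    rw [lintegral_eq_zero_iff hσm, EventuallyEq, ae_restrict_iff' measurableSet_ball] at h0
    have : volume P = 0 := by
      refine measure_mono_null (fun y hy => ?_) (ae_iff.1 h0)
      obtain ⟨h1, h2⟩ := hPσ hy
      rw [ha0] at h2
      exact fun hcon => (show 0 < σ y from h2).ne' (hcon h1)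
    rw [this]
    exact zero_le
  · exact (ENNReal.mul_le_mul_iff_right ha0 hat).1 hvolP

/-- H is assigned pointwise to an index attaining the finite supremum. In the induction, H goes to
the new index exactly where it beats the earlier ones. -/
theorem exists_decomposition_mul_biSup_le {ι : Type*} {a : ι → (Fin n → ℝ) → ℝ≥0∞}
    (ha : ∀ k, Measurable (a k)) (S : Finset ι) :
    ∀ H : (Fin n → ℝ) → ℝ≥0∞, Measurable H → ∃ h : ι → (Fin n → ℝ) → ℝ≥0∞,
      (∀ k, Measurable (h k)) ∧ (∀ x, ∑ k ∈ S, h k x ≤ H x) ∧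
      ∀ x, (⨆ k ∈ S, a k x) * H x ≤ ∑ k ∈ S, a k x * h k x := by
  classical
  induction S using Finset.induction_on with
  | empty => exact fun H _ => ⟨fun _ _ => 0, fun _ => measurable_const, by simp, by simp⟩
  | insert i S hi ih =>
    intro H hH
    have hsup : Measurable fun x => ⨆ k ∈ S, a k x := by
      exact Measurable.biSup _ S.countable_toSet fun k _ => ha k
    set A := {x | a i x ≤ ⨆ k ∈ S, a k x} with hA
    have hAm : MeasurableSet A := measurableSet_le (ha i) hsup
    obtain ⟨h, h1, h2, h3⟩ := ih (A.indicator H) (hH.indicator hAm)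
    refine ⟨fun k => if k = i then Aᶜ.indicator H else h k, fun k => ?_, fun x => ?_, fun x => ?_⟩
    · dsimp only
      split_ifs
      · exact hH.indicator hAm.compl
      · exact h1 k
    · have : ∑ k ∈ S, (if k = i then Aᶜ.indicator H else h k) x = ∑ k ∈ S, h k x :=
        Finset.sum_congr rfl fun k hk => by rw [if_neg (ne_of_mem_of_not_mem hk hi)]
      rw [Finset.sum_insert hi, this]
      simp only [if_true]
      calc Aᶜ.indicator H x + ∑ k ∈ S, h k x ≤ Aᶜ.indicator H x + A.indicator H x := by
            gcongr
            exact h2 x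
        _ = H x := by
            by_cases hx : x ∈ A <;> simp [hx]
    · have : ∑ k ∈ S, a k x * (if k = i then Aᶜ.indicator H else h k) x =
          ∑ k ∈ S, a k x * h k x :=
        Finset.sum_congr rfl fun k hk => by rw [if_neg (ne_of_mem_of_not_mem hk hi)]
      rw [Finset.sum_insert hi, this, Finset.iSup_insert]
      simp only [if_true]
      by_cases hx : x ∈ A
      · have hx' : a i x ≤ ⨆ k ∈ S, a k x := hx
        have := h3 x
        rw [indicator_of_mem hx] at this
        rw [sup_eq_right.2 hx']
        exact this.trans le_add_self
      · have hx' : ⨆ k ∈ S, a k x ≤ a i x := (not_le.1 hx).le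
        rw [sup_eq_left.2 hx', indicator_of_mem (show x ∈ Aᶜ from hx)]
        exact le_self_add

end BallAverage

/-! ### Boundedness on the associate space -/

section Duality

variable {𝕜 : Type*} [RCLike 𝕜] {n : ℕ} {X : FunctionSpace 𝕜 n}

theorem IsBanachFunctionSpace.phi_mul_normOf_le (hX : IsBanachFunctionSpace X) (s : ℝ)
    {κ : ℝ≥0∞} (hκ : κ ≤ phi X s) {g : (Fin n → ℝ) → ℝ≥0∞} (hg : X.normOf g < ∞) :
    κ * X.normOf g ≤ X.normOf (localMaximal s g) := by
  by_cases h0 : X.normOf g = 0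
  · rw [h0, mul_zero]; exact zero_le
  obtain ⟨f, -, hf, hfX⟩ := exists_rep hg
  set c : ℝ≥0∞ := (X.normOf g)⁻¹ with hc
  have hc0 : c ≠ 0 := ENNReal.inv_ne_zero.2 hg.ne
  have hct : c ≠ ∞ := ENNReal.inv_ne_top.2 h0
  have h1 : X (((c.toReal : ℝ) : 𝕜) • f) = 1 := by
    rw [hX.smul, enorm_ofReal_toReal (lt_top_iff_ne_top.2 hct), ← hfX X,
      ENNReal.inv_mul_cancel h0 hg.ne]
  have h2 : κ ≤ X.normOf (localMaximal s fun x => ‖(((c.toReal : ℝ) : 𝕜) • f) x‖ₑ) :=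
    hκ.trans (iInf₂_le (f := fun (f : L0 𝕜 n) (_ : X f = 1) =>
      X.normOf (localMaximal s fun x => ‖f x‖ₑ)) _ h1)
  have h3 : localMaximal s (fun x => ‖(((c.toReal : ℝ) : 𝕜) • f) x‖ₑ) =
      fun x => c * localMaximal s g x := by
    rw [← funext fun x => localMaximal_const_mul s hc0 hct g x]
    refine localMaximal_congr_ae s ?_
    filter_upwards [hf, AEEqFun.coeFn_smul ((c.toReal : ℝ) : 𝕜) f] with x hx1 hx2
    rw [hx2, Pi.smul_apply, enorm_smul, hx1, enorm_ofReal_toReal (lt_top_iff_ne_top.2 hct)]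
  rw [h3, hX.normOf_const_mul hc0 hct, hc, mul_comm, ← div_eq_mul_inv,
    ENNReal.le_div_iff_mul_le (Or.inl h0) (Or.inl hg.ne)] at h2
  exact h2

/-- If `φ_X` exceeds `1` somewhere then it is unbounded. -/
theorem IsBanachFunctionSpace.exists_mul_normOf_le_localMaximal (hX : IsBanachFunctionSpace X)
    {s₀ : ℝ} (hs₀ : s₀ ∈ Ioo (0 : ℝ) 1) (h : 1 < phi X s₀) {K : ℝ≥0∞} (hK : K ≠ ∞) :
    ∃ s : ℝ, 0 < s ∧ ∀ g : (Fin n → ℝ) → ℝ≥0∞, X.normOf g < ∞ →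
      K * X.normOf g ≤ X.normOf (localMaximal s g) := by
  obtain ⟨κ, hκ1, hκ⟩ := exists_between h
  set q : ℝ := (1 / 15) ^ n * s₀ with hq
  have hs₀0 := hs₀.1
  have hq0 : 0 < q := by positivity
  have hqs : q ≤ s₀ :=
    mul_le_of_le_one_left hs₀0.le (pow_le_one₀ (by norm_num) (by norm_num))
  have hq1 : q ≤ 1 := hqs.trans hs₀.2.le
  have key : ∀ (k : ℕ) (g : (Fin n → ℝ) → ℝ≥0∞), X.normOf g < ∞ →
      κ ^ (k + 1) * X.normOf g ≤ X.normOf (localMaximal (q ^ (k + 1)) g) := by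
    intro k g hg
    induction k with
    | zero =>
      rw [zero_add, pow_one, pow_one]
      exact (hX.phi_mul_normOf_le s₀ hκ.le hg).trans (hX.normOf_mono
        (measurable_localMaximal _ _).aemeasurable
        (Eventually.of_forall fun x => localMaximal_mono hqs g x))
    | succ k ih =>
      -- The φ inequality requires the previous local maximal function to lie in X; monotonicity in
      -- the threshold guarantees this unless the right side is infinite.
      by_cases htop : X.normOf (localMaximal (q ^ (k + 1 + 1)) g) = ∞
      · rw [htop]; exact le_top
      have hfin : X.normOf (localMaximal (q ^ (k + 1)) g) < ∞ := by
        refine lt_of_le_of_lt (hX.normOf_mono (measurable_localMaximal _ _).aemeasurable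
          (Eventually.of_forall fun x => localMaximal_mono ?_ g x)) (lt_top_iff_ne_top.2 htop)
        exact pow_le_pow_of_le_one hq0.le hq1 (Nat.le_succ _)
      rw [pow_succ' κ, mul_assoc]
      refine (mul_le_mul_right ih κ).trans ((hX.phi_mul_normOf_le s₀ hκ.le hfin).trans ?_)
      refine hX.normOf_mono (measurable_localMaximal _ _).aemeasurable
        (Eventually.of_forall fun x => (localMaximal_comp_le hs₀0 hs₀.2.le (by positivity) g
          x).trans (le_of_eq ?_))
      congr 1
      rw [hq]; ring
  obtain ⟨k, hk⟩ := ((ENNReal.tendsto_pow_atTop_nhds_top_iff.2 hκ1).eventually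
    (lt_mem_nhds (lt_top_iff_ne_top.2 hK))).and (eventually_ge_atTop 1) |>.exists
  obtain ⟨j, rfl⟩ := Nat.exists_eq_add_of_le' hk.2
  exact ⟨q ^ (j + 1), by positivity, fun g hg =>
    (mul_le_mul_left hk.1.le _).trans (key j g hg)⟩

/-- With N = sup_j ‖T_j‖, expansion of m_s and the pointwise bound give 2^(n+1) N ≤ 2^n N + D, hence
2^n N ≤ D. The supremum over j is needed since each step passes from T_j to T_{j+1}. -/
theorem IsBanachFunctionSpace.normOf_sum_ballAverage_le (hX : IsBanachFunctionSpace X)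
    {C : ℝ≥0} (hC : ∀ g : (Fin n → ℝ) → ℝ≥0∞, X.normOf (maximal g) ≤ C * X.normOf g)
    {s : ℝ} (hs : 0 < s) (hφ : ∀ g : (Fin n → ℝ) → ℝ≥0∞, X.normOf g < ∞ →
      2 ^ (n + 1) * X.normOf g ≤ X.normOf (localMaximal s g))
    {ι : Type*} (S : Finset ι) {ρ : ι → ℝ} (hρ : ∀ k, 0 < ρ k)
    {f : ι → (Fin n → ℝ) → ℝ≥0∞} (hf : ∀ k, Measurable (f k))
    {F : (Fin n → ℝ) → ℝ≥0∞} (hF : ∀ x, ∑ k ∈ S, f k x ≤ F x) (hFX : X.normOf F < ∞) :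
    X.normOf (fun y => ∑ k ∈ S, ballAverage (ρ k) (f k) y) ≤
      3 ^ n / ENNReal.ofReal s * (C * X.normOf F) := by
  set T : ℕ → (Fin n → ℝ) → ℝ≥0∞ := fun j y => ∑ k ∈ S, ballAverage (2 ^ j * ρ k) (f k) y with hT
  have hρj : ∀ (j : ℕ) k, 0 < 2 ^ j * ρ k := fun j k => mul_pos (by positivity) (hρ k)
  have hTm : ∀ j, Measurable (T j) := fun j =>
    Finset.measurable_fun_sum _ fun k _ => measurable_ballAverage _ (hf k)
  set N := ⨆ j, X.normOf (T j) with hN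
  set D := 3 ^ n / ENNReal.ofReal s * (C * X.normOf F) with hD
  -- This bound depends on the number of scales and serves only to make N finite, so that it can be
  -- subtracted.
  have hapriori : ∀ j, X.normOf (T j) ≤ S.card * (C * X.normOf F) := by
    intro j
    calc X.normOf (T j) ≤ X.normOf (fun y => ∑ _k ∈ S, maximal F y) := by
          refine hX.normOf_mono (hTm j).aemeasurable (Eventually.of_forall fun y =>
            Finset.sum_le_sum fun k hk => ?_)
          refine (ballAverage_mono_of_le (fun x => ?_) y).trans
            (ballAverage_le_maximal (hρj j k) F y)
          exact (Finset.single_le_sum (f := fun k => f k x) (fun _ _ => zero_le) hk).trans (hF x)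
      _ ≤ ∑ _k ∈ S, X.normOf (maximal F) := hX.normOf_sum_le S fun _ => maximal F
      _ ≤ S.card * (C * X.normOf F) := by
          rw [Finset.sum_const, nsmul_eq_mul]
          gcongr
          exact hC F
  have hbound : (S.card : ℝ≥0∞) * (C * X.normOf F) < ∞ :=
    ENNReal.mul_lt_top (ENNReal.natCast_lt_top _) (ENNReal.mul_lt_top ENNReal.coe_lt_top hFX)
  have hNfin : N ≠ ∞ := ((iSup_le hapriori).trans_lt hbound).ne
  have hs0 : ENNReal.ofReal s ≠ 0 := by simpa using hs
  have hstep : ∀ j, 2 ^ (n + 1) * X.normOf (T j) ≤ 2 ^ n * N + D := by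
    intro j
    refine (hφ (T j) ((hapriori j).trans_lt hbound)).trans ?_
    calc X.normOf (localMaximal s (T j))
        ≤ X.normOf (fun x => 2 ^ n * T (j + 1) x + 3 ^ n / ENNReal.ofReal s * maximal F x) := by
          refine hX.normOf_mono (measurable_localMaximal _ _).aemeasurable
            (Eventually.of_forall fun x => ?_)
          refine (localMaximal_sum_ballAverage_le S (hρj j) hf hF hs x).trans (le_of_eq ?_)
          simp only [hT, pow_succ', mul_assoc]
      _ ≤ 2 ^ n * X.normOf (T (j + 1)) + 3 ^ n / ENNReal.ofReal s * X.normOf (maximal F) := by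
          refine (hX.normOf_add_le _ _).trans (add_le_add
            (hX.normOf_const_mul_le (by positivity) (ENNReal.pow_ne_top (by norm_num)) _)
            (hX.normOf_const_mul_le ?_ ?_ _))
          · exact (ENNReal.div_pos (by positivity) ENNReal.ofReal_ne_top).ne'
          · exact ENNReal.div_ne_top (ENNReal.pow_ne_top (by norm_num)) hs0
      _ ≤ 2 ^ n * N + D := by
          gcongr
          · exact le_iSup (fun j => X.normOf (T j)) (j + 1)
          · rw [hD]
            gcongr
            exact hC F
  have hN2 : 2 ^ n * N + 2 ^ n * N ≤ 2 ^ n * N + D := by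
    have h1 : 2 ^ (n + 1) * N ≤ 2 ^ n * N + D := by
      rw [hN, ENNReal.mul_iSup]
      exact iSup_le hstep
    rwa [pow_succ, mul_assoc, two_mul, mul_add] at h1
  have hN3 : 2 ^ n * N ≤ D :=
    (ENNReal.add_le_add_iff_left (ENNReal.mul_ne_top (ENNReal.pow_ne_top (by norm_num)) hNfin)).1 hN2
  have hT0 : (fun y => ∑ k ∈ S, ballAverage (ρ k) (f k) y) = T 0 := by simp [hT]
  rw [hT0]
  refine (le_iSup (fun j => X.normOf (T j)) 0).trans (le_trans ?_ hN3)
  exact le_mul_of_one_le_left zero_le (one_le_pow₀ one_le_two)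

/-- For finitely many scales, linearization and self-adjointness move the averages from G onto
pieces of H, where the absorption bound holds uniformly in the set of scales; monotone convergence
then covers all scales. -/
theorem MaximalBoundedOn.associate (hX : IsBanachFunctionSpace X) (h : MaximalBoundedOn X)
    {s₀ : ℝ} (hs₀ : s₀ ∈ Ioo (0 : ℝ) 1) (hφ : 1 < phi X s₀) :
    MaximalBoundedOn X.associate := by
  obtain ⟨C, -, hC⟩ := h.exists_normOf_maximal_le
  obtain ⟨s, hs, hs'⟩ := hX.exists_mul_normOf_le_localMaximal hs₀ hφ
    (K := 2 ^ (n + 1)) (ENNReal.pow_ne_top (by norm_num))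
  have hs0 : ENNReal.ofReal s ≠ 0 := by simpa using hs
  set D : ℝ≥0∞ := 3 ^ n / ENNReal.ofReal s * C with hD
  have hDt : D ≠ ∞ := ENNReal.mul_ne_top
    (ENNReal.div_ne_top (ENNReal.pow_ne_top (by norm_num)) hs0) ENNReal.coe_ne_top
  have hB : 4 ^ n * D ≠ ∞ := ENNReal.mul_ne_top (ENNReal.pow_ne_top (by norm_num)) hDt
  refine ⟨(4 ^ n * D).toNNReal, fun f hf => ?_⟩
  rw [ENNReal.coe_toNNReal hB]
  set G : (Fin n → ℝ) → ℝ≥0∞ := fun x => ‖f x‖ₑ with hG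
  have hGm : Measurable G := measurable_enorm_coe f
  refine hX.associate_normOf_le (measurable_maximal G) (ENNReal.mul_ne_top hB hf.ne)
    fun H hH hHX => ?_
  set a : ℤ → (Fin n → ℝ) → ℝ≥0∞ := fun k => ballAverage ((2 : ℝ) ^ k) G with ha
  have ham : ∀ k, Measurable (a k) := fun k => measurable_ballAverage _ hGm
  have hfinite : ∀ S : Finset ℤ, ∫⁻ x, (⨆ k ∈ S, a k x) * H x ≤
      X.associate f * (D * X.normOf H) := by
    intro S
    obtain ⟨h, hm, hsum, hle⟩ := exists_decomposition_mul_biSup_le ham S H hH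
    have hT := hX.normOf_sum_ballAverage_le hC hs hs' S (ρ := fun k : ℤ => (2 : ℝ) ^ k)
      (fun k => by positivity) hm hsum hHX
    rw [← mul_assoc] at hT
    calc ∫⁻ x, (⨆ k ∈ S, a k x) * H x ≤ ∫⁻ x, ∑ k ∈ S, a k x * h k x := lintegral_mono hle
      _ = ∑ k ∈ S, ∫⁻ x, a k x * h k x := lintegral_finsetSum _ fun k _ => (ham k).mul (hm k)
      _ = ∑ k ∈ S, ∫⁻ x, G x * ballAverage ((2 : ℝ) ^ k) (h k) x := by
          refine Finset.sum_congr rfl fun k _ => ?_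
          rw [lintegral_mul_ballAverage_comm _ hGm (hm k)]
          simp only [ha, mul_comm]
      _ = ∫⁻ x, ∑ k ∈ S, G x * ballAverage ((2 : ℝ) ^ k) (h k) x :=
          (lintegral_finsetSum _ fun k _ => hGm.mul (measurable_ballAverage _ (hm k))).symm
      _ = ∫⁻ x, ‖f x‖ₑ * ∑ k ∈ S, ballAverage ((2 : ℝ) ^ k) (h k) x := by
          simp only [Finset.mul_sum, hG]
      _ ≤ _ := (hX.lintegral_mul_le_associate f
          (hT.trans_lt (ENNReal.mul_lt_top (lt_top_iff_ne_top.2 hDt) hHX))).trans (by gcongr)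
  have hbiSup : ∀ S : Finset ℤ, Measurable fun x => (⨆ k ∈ S, a k x) * H x := fun S =>
    (Measurable.biSup _ S.countable_toSet fun k _ => ham k).mul hH
  calc ∫⁻ x, maximal G x * H x
      ≤ ∫⁻ x, 4 ^ n * ⨆ S : Finset ℤ, (⨆ k ∈ S, a k x) * H x := by
        refine lintegral_mono fun x => ?_
        rw [← ENNReal.iSup_mul, ← mul_assoc, ← iSup_eq_iSup_finset]
        gcongr
        exact maximal_le_iSup_ballAverage G x
    _ = 4 ^ n * ⨆ S : Finset ℤ, ∫⁻ x, (⨆ k ∈ S, a k x) * H x := by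
        rw [lintegral_const_mul _ (Measurable.iSup hbiSup),
          lintegral_iSup_directed (fun S => (hbiSup S).aemeasurable)]
        refine Monotone.directed_le fun S S' hSS' x => ?_
        exact mul_le_mul_left (biSup_mono (f := fun k => a k x) fun k hk => hSS' hk) (H x)
    _ ≤ 4 ^ n * (X.associate f * (D * X.normOf H)) := by
        gcongr
        exact iSup_le hfinite
    _ = _ := by ring

end Duality

end MaximalBFS

end

theorem theorem1p1 {𝕜 : Type*} [RCLike 𝕜] {n : ℕ} (hn : 0 < n)
    (X : MaximalBFS.FunctionSpace 𝕜 n) (hX : MaximalBFS.IsBanachFunctionSpace X) :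
    -- part (i) under the weaker assumption of `A_∞`-regularity
    (MaximalBFS.IsAInftyRegular X →
      MaximalBFS.UnboundedOnUnit (MaximalBFS.phi X.associate) ∧
      MaximalBFS.HasPowerLowerBound (MaximalBFS.phi X.associate)) ∧
    (MaximalBFS.MaximalBoundedOn X →
      -- part (i)
      (MaximalBFS.UnboundedOnUnit (MaximalBFS.phi X.associate) ∧
        MaximalBFS.HasPowerLowerBound (MaximalBFS.phi X.associate)) ∧
      -- part (ii)
      ((∃ s₀ ∈ Set.Ioo (0 : ℝ) 1, 1 < MaximalBFS.phi X s₀) →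
        MaximalBFS.MaximalBoundedOn X.associate)) := by
  exact ⟨fun h => ⟨(h.hasPowerLowerBound hn hX).unboundedOnUnit, h.hasPowerLowerBound hn hX⟩,
    fun h => ⟨⟨((h.isAInftyRegular hX).hasPowerLowerBound hn hX).unboundedOnUnit,
      (h.isAInftyRegular hX).hasPowerLowerBound hn hX⟩,
      fun ⟨_, hs₀, hφ⟩ => h.associate hX hs₀ hφ⟩⟩
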